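/- Notation. Let $X,Y,Z$ be the Pauli matrices, $\sigma_{00}=I$, $\sigma_{01}=Z$, $\sigma_{10}=X$, $\sigma_{11}=Y$, and let $|\Phi_{00}\rangle=\frac{|00\rangle+|11\rangle}{\sqrt2}$, $|\Phi_{01}\rangle=\frac{|00\rangle-|11\rangle}{\sqrt2}$, $|\Phi_{10}\rangle=\frac{|01\rangle+|10\rangle}{\sqrt2}$, $|\Phi_{11}\rangle=\frac{|01\rangle-|10\rangle}{\sqrt2}$ be the Bell states. Sums of the bits $\alpha_i,\beta_i\in\{0,1\}$ are taken modulo $2$. Pure entanglement can be *distilled* from a multipartite state $\rho$ between two of the parties if there is a fixed entangled pure state $\psi$ of these two parties such that for every $\varepsilon>0$ some number of copies of $\rho$ can be transformed, by local operations and classical communication (LOCC) among all the parties, into a state $\varepsilon$-close to $\psi$. A state of $N$ qubits, held by $N$ parties, is *bound entangled* if it is not fully separable and no pure entanglement can be distilled between any two of the parties. It is *unlockable* bound entangled if, moreover, the parties can be divided into groups, each acting collectively as a single party, such that pure entanglement can be distilled between some two different groups. For $m\ge1$ let $\rho^{(2m)}$ be the maximally mixed state over the subspace of $(\mathbb C^2)^{\otimes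 2m}$ stabilized by $X^{\otimes 2m}$ and $Z^{\otimes 2m}$ (the normalized projector onto their simultaneous eigenspace with eigenvalues $1,1$). The generalized Smolin states are $\rho_2^{\rm Sm}=|\Phi_{11}\rangle\langle\Phi_{11}|$ and $\rho_{2m+2}^{\rm Sm}=\frac14\sum_{\alpha,\beta}\sigma_{\alpha\beta}\,\rho^{\rm Sm}_{2m}\,\sigma_{\alpha\beta}^\dagger\otimes\sigma_{\alpha\beta}\,\rho_2^{\rm Sm}\,\sigma_{\alpha\beta}^\dagger$, where $\sigma_{\alpha\beta}$ acts on the first qubit of each factor. Statement. For every $n\ge2$: 1. $\rho^{(2n)}=\frac1{4^n}(I+X^{\otimes 2n})(I+Z^{\otimes 2n})$. 2. $\rho^{(2n)}$ is separable with respect to every partition of the $2n$ parties into pairs. 3. $\rho^{(2n)}$ is an unlockable bound entangled state. 4. For any two parties $i\ne j$ the other $2n-2$ parties can be grouped into pairs, and for every such grouping (with $i$ and $j$ remaining separate) pure entanglement can be distilled from $\rho^{(2n)}$ between $i$ and $j$. 5. $\rho^{(2n)}=Q\,\rho^{\rm Sm}_{2n}\,Q^\dagger$ for some tensor product $Q$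 of single-qubit Pauli matrices. 6. For every division of the parties into $n$ ordered pairs, $\rho^{(2n)}=\frac1{4^{n-1}}\sum\bigotimes_{i=1}^n|\Phi_{\alpha_i\beta_i}\rangle\langle\Phi_{\alpha_i\beta_i}|$, where the $i$-th factor acts on the $i$-th pair and the sum is over all $\alpha,\beta\in\{0,1\}^n$ with $\sum_i\alpha_i=\sum_i\beta_i=0$. 7. $\rho^{(2n)}$ is invariant under all permutations of the parties. 8. For every division into $n$ ordered pairs and every $k$: if all the pairs $i\ne k$ are measured in the Bell basis, every list of outcomes $(\alpha_i,\beta_i)_{i\neq k}$ has probability $\frac1{4^{n-1}}$, and it leaves the pair $k$ in the Bell state $|\Phi_{\alpha\beta}\rangle$ with $\alpha=\sum_{i\ne k}\alpha_i$, $\beta=\sum_{i\ne k}\beta_i$. 9. The four simultaneous eigenspaces of $X^{\otimes 2n}$ and $Z^{\otimes 2n}$ with eigenvalues $(\pm1,\pm1)$ are mutually orthogonal, span the whole space, have dimension $4^{n-1}$ each, and the normalized projector onto each of them is an unlockable bound entangled state. Moreover, for every $m\ge1$, $\rho^{(2m+2)}=\frac14\sum_{\alpha,\beta}\sigma_{\alpha\beta}\,\rho^{(2m)}\,\sigma_{\alpha\beta}^\dagger\otimes|\Phi_{\alpha\beta}\rangle\langle\Phi_{\alpha\beta}|$,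 with $\sigma_{\alpha\beta}$ acting on the first qubit. -/

import Mathlib

open scoped Matrix BigOperators ComplexOrder

noncomputable section

/-! ### States of multipartite systems -/

/-- Operators on the joint system `⨂ₚ ℂ^(H p)` of the parties `p : P`, as matrices in the
computational basis. -/
abbrev MultiOp {P : Type} (H : P → Type) : Type := Matrix (∀ p, H p) (∀ p, H p) ℂ

/-- Operators on a register with one qubit for each element of `ι`. -/
abbrev QubitOp (ι : Type) : Type := MultiOp (fun _ : ι => Fin 2)

/-- The tensor product `⨂ₚ A p` of local (possibly rectangular) matrices. -/
def piTensor {P : Type} [Fintype P] {H L : P → Type} (A : ∀ p, Matrix (L p) (H p) ℂ) :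
    Matrix (∀ p, L p) (∀ p, H p) ℂ :=
  Matrix.of fun y x => ∏ p, A p (y p) (x p)

/-- Density matrices. -/
def IsDensity {m : Type} [Fintype m] (ρ : Matrix m m ℂ) : Prop :=
  ρ.PosSemidef ∧ ρ.trace = 1

/-- Full separability: `ρ` is a finite convex combination of products of local states of the
parties. -/
def IsFullySeparable {P : Type} [Fintype P] {H : P → Type} [∀ p, Fintype (H p)]
    (ρ : MultiOp H) : Prop :=
  ∃ (m : ℕ) (w : Fin m → ℝ) (σ : Fin m → ∀ p, Matrix (H p) (H p) ℂ),
    (∀ k, 0 < w k) ∧ ∑ k, w k = 1 ∧ (∀ k p, IsDensity (σ k p)) ∧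
      ρ = ∑ k, (w k : ℂ) • piTensor (σ k)

/-- The state `ρ^{⊗ k}`: party `p` holds its part of each of the `k` copies. -/
def copies {P : Type} {H : P → Type} (k : ℕ) (ρ : MultiOp H) :
    MultiOp (fun p => Fin k → H p) :=
  Matrix.of fun x y => ∏ c, ρ (fun p => x p c) (fun p => y p c)

/-! ### Local operations and classical communication -/

/-- `IsLOCC H Λ`: the map `Λ`, from operators on the system `H` to operators on the system `H'`,
is implemented by a protocol of finitely many rounds. In a round every party `p` applies a local
measurement with Kraus operators `K p a` from its space `H p` to a space `L p`, and announces the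
outcome `a` publicly; the protocol then continues in a way that may depend on all outcomes
announced so far. (A party that does nothing has one outcome and the identity as its Kraus
operator; adjoining ancillas, local unitaries and discarding subsystems are special cases.) -/
inductive IsLOCC {P : Type} [Fintype P] [DecidableEq P] {H' : P → Type}
    [∀ p, Fintype (H' p)] [∀ p, DecidableEq (H' p)] :
    (H : P → Type) → [∀ p, Fintype (H p)] → [∀ p, DecidableEq (H p)] →
      (MultiOp H → MultiOp H') → Prop
  | done : IsLOCC H' (fun ρ => ρ)
  | round {H L O : P → Type}
      [∀ p, Fintype (H p)] [∀ p, DecidableEq (H p)]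
      [∀ p, Fintype (L p)] [∀ p, DecidableEq (L p)]
      [∀ p, Fintype (O p)]
      (K : ∀ p, O p → Matrix (L p) (H p) ℂ)
      (complete : ∀ p, ∑ a, (K p a)ᴴ * K p a = 1)
      (next : (∀ p, O p) → MultiOp L → MultiOp H')
      (locc : ∀ a, IsLOCC L (next a)) :
      IsLOCC H (fun ρ => ∑ a : ∀ p, O p,
        next a (piTensor (fun p => K p (a p)) * ρ * (piTensor (fun p => K p (a p)))ᴴ))

/-- Pure entanglement can be distilled from `ρ` between the parties `p` and `q`: there is an
entangled pure state `ψ` shared by `p` and `q` (each other party is left with a trivial system)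
such that LOCC among all the parties turns sufficiently many copies of `ρ` into a state as close
to `ψ` as desired. -/
def DistillableBetween {P : Type} [Fintype P] [DecidableEq P] {H : P → Type}
    [∀ p, Fintype (H p)] [∀ p, DecidableEq (H p)] (ρ : MultiOp H) (p q : P) : Prop :=
  ∃ (H' : P → Type) (_ : ∀ r, Fintype (H' r)) (_ : ∀ r, DecidableEq (H' r))
    (ψ : (∀ r, H' r) → ℂ),
    (∀ r, r ≠ p → r ≠ q → Subsingleton (H' r)) ∧
    ∑ x, ‖ψ x‖ ^ 2 = 1 ∧
    (¬ ∃ φ : ∀ r, H' r → ℂ, ∀ x, ψ x = ∏ r, φ r (x r)) ∧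
    ∀ ε : ℝ, 0 < ε → ∃ (k : ℕ) (Λ : MultiOp (fun r => Fin k → H r) → MultiOp H'),
      IsLOCC (fun r => Fin k → H r) Λ ∧
      ∀ x y, ‖Λ (copies k ρ) x y - ψ x * star (ψ y)‖ < ε

/-! ### Grouping qubits, unlockable bound entanglement -/

section Register

variable {ι : Type} [Fintype ι] [DecidableEq ι]

/-- The basis label of the whole register given by basis labels of the blocks of a partition. -/
def glue (π : Finpartition (Finset.univ : Finset ι))
    (x : ∀ T : {T // T ∈ π.parts}, ({i // i ∈ T.1} → Fin 2)) : ι → Fin 2 :=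
  fun i => x ⟨π.part i, π.part_mem.2 (Finset.mem_univ i)⟩
    ⟨i, π.mem_part (Finset.mem_univ i)⟩

/-- The state `ρ` of the register, when the qubits of each block of `π` are held by one party. -/
def groupState (π : Finpartition (Finset.univ : Finset ι)) (ρ : QubitOp ι) :
    MultiOp (fun T : {T // T ∈ π.parts} => ({i // i ∈ T.1} → Fin 2)) :=
  ρ.submatrix (glue π) (glue π)

/-- Separability with respect to a partition of the qubits. -/
def SeparableWrt (π : Finpartition (Finset.univ : Finset ι)) (ρ : QubitOp ι) : Prop :=
  IsFullySeparable (groupState π ρ)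

/-- An entangled state from which no pure entanglement can be distilled between any two qubits
as long as all the qubits are in separate hands. -/
def IsBoundEntangled (ρ : QubitOp ι) : Prop :=
  IsDensity ρ ∧ ¬ IsFullySeparable ρ ∧ ∀ i j : ι, i ≠ j → ¬ DistillableBetween ρ i j

/-- A bound entangled state such that, for some division of the qubits into groups which act
collectively, pure entanglement can be distilled between two of the groups. -/
def IsUnlockableBoundEntangled (ρ : QubitOp ι) : Prop :=
  IsBoundEntangled ρ ∧
    ∃ (π : Finpartition (Finset.univ : Finset ι)) (A B : {T // T ∈ π.parts}),
      A ≠ B ∧ DistillableBetween (groupState π ρ) A B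

/-- The subspace of the simultaneous eigenvectors of the operators `g k` with eigenvalues `c k`. -/
def jointEigenspace {κ : Type} (g : κ → QubitOp ι) (c : κ → ℂ) :
    Submodule ℂ (EuclideanSpace ℂ (ι → Fin 2)) :=
  ⨅ k, Module.End.eigenspace (Matrix.toEuclideanLin (g k)) (c k)

/-- The normalized orthogonal projector onto a subspace. -/
def maxMixed (V : Submodule ℂ (EuclideanSpace ℂ (ι → Fin 2))) : QubitOp ι :=
  (Module.finrank ℂ V : ℂ)⁻¹ •
    (Matrix.toEuclideanCLM (n := ι → Fin 2) (𝕜 := ℂ)).symm V.starProjection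

end Register

/-! ### Pauli operators, Bell states, generalized Smolin states -/

/-- The Pauli matrices `σ₀₀ = I`, `σ₀₁ = Z`, `σ₁₀ = X`, `σ₁₁ = Y`. -/
def pauli : Fin 2 → Fin 2 → Matrix (Fin 2) (Fin 2) ℂ
  | 0, 0 => 1
  | 0, 1 => !![1, 0; 0, -1]
  | 1, 0 => !![0, 1; 1, 0]
  | 1, 1 => !![0, -Complex.I; Complex.I, 0]

/-- The Bell vectors `Φ₀₀ = (|00⟩ + |11⟩)/√2`, `Φ₀₁ = (|00⟩ - |11⟩)/√2`,
`Φ₁₀ = (|01⟩ + |10⟩)/√2`, `Φ₁₁ = (|01⟩ - |10⟩)/√2`. -/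
def bell (α β : Fin 2) : (Fin 2 → Fin 2) → ℂ :=
  fun x => if x 1 = x 0 + α then (-1) ^ ((β : ℕ) * (x 0 : ℕ)) / (Real.sqrt 2 : ℂ) else 0

/-- The projector `|Φ_{αβ}⟩⟨Φ_{αβ}|`. -/
def bellProj (α β : Fin 2) : QubitOp (Fin 2) :=
  Matrix.of fun x y => bell α β x * star (bell α β y)

/-- The tensor power `A^{⊗ m}`. -/
def allQubits (m : ℕ) (A : Matrix (Fin 2) (Fin 2) ℂ) : QubitOp (Fin m) :=
  piTensor fun _ => A

/-- The single-qubit operator `A` acting on the first of `m` qubits. -/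
def onFirst (m : ℕ) (A : Matrix (Fin 2) (Fin 2) ℂ) : QubitOp (Fin m) :=
  piTensor fun i => if (i : ℕ) = 0 then A else 1

/-- `A ⊗ B` for `A` on the first `m` qubits and `B` on the last two. -/
def tensorPair {m : ℕ} (A : QubitOp (Fin m)) (B : QubitOp (Fin 2)) : QubitOp (Fin (m + 2)) :=
  Matrix.of fun x y =>
    A (fun i => x (Fin.castAdd 2 i)) (fun i => y (Fin.castAdd 2 i)) *
      B (fun j => x (Fin.natAdd m j)) (fun j => y (Fin.natAdd m j))

/-- The `i`-th factor `A i` acts on the pair of qubits `e (i, 0)`, `e (i, 1)`. -/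
def pairTensor {n : ℕ} (e : Fin n × Fin 2 ≃ Fin (2 * n)) (A : Fin n → QubitOp (Fin 2)) :
    QubitOp (Fin (2 * n)) :=
  Matrix.of fun x y => ∏ i, A i (fun j => x (e (i, j))) (fun j => y (e (i, j)))

/-- The operator `I ⊗ ⨂_{i ≠ k} ⟨Φ_{α i, β i}|` which describes Bell measurements on all the pairs
`e (i, 0)`, `e (i, 1)` with `i ≠ k`, with outcomes `(α i, β i)`. The pair `k` is left over. -/
def bellMeasurement {n : ℕ} (e : Fin n × Fin 2 ≃ Fin (2 * n)) (k : Fin n)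
    (α β : Fin n → Fin 2) : Matrix (Fin 2 → Fin 2) (Fin (2 * n) → Fin 2) ℂ :=
  Matrix.of fun w x =>
    if w = (fun j => x (e (k, j))) then
      ∏ i ∈ Finset.univ.erase k, star (bell (α i) (β i) (fun j => x (e (i, j))))
    else 0

/-- The generalized Smolin state of `2 n` qubits: the singlet for `n = 1`, and then
`ρ_{2n+2} = ¼ ∑_σ σ ρ_{2n} σ† ⊗ σ ρ₂ σ†`, the sum being over the four Pauli matrices, each acting
on one qubit of each factor. (The value at `n = 0` is a convention.) -/
def genSmolin : (n : ℕ) → QubitOp (Fin (2 * n))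
  | 0 => 1
  | 1 => bellProj 1 1
  | n + 2 => (1 / 4 : ℂ) • ∑ α : Fin 2, ∑ β : Fin 2,
      tensorPair
        (onFirst (2 * (n + 1)) (pauli α β) * genSmolin (n + 1) *
          (onFirst (2 * (n + 1)) (pauli α β))ᴴ)
        (onFirst 2 (pauli α β) * bellProj 1 1 * (onFirst 2 (pauli α β))ᴴ)

/-- The generators `X^{⊗ 2n}` (index `0`) and `Z^{⊗ 2n}` (index `1`). -/
def xzGenerators (n : ℕ) : Fin 2 → QubitOp (Fin (2 * n)) :=
  ![allQubits (2 * n) (pauli 1 0), allQubits (2 * n) (pauli 0 1)]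

/-- The maximally mixed state over the subspace stabilized by `X^{⊗ 2n}` and `Z^{⊗ 2n}`. -/
def xzState (n : ℕ) : QubitOp (Fin (2 * n)) :=
  maxMixed (jointEigenspace (xzGenerators n) fun _ => 1)

/-- The simultaneous eigenspace of `X^{⊗ 2n}`, `Z^{⊗ 2n}` with eigenvalues
`(-1)^{s.1}`, `(-1)^{s.2}`. -/
def xzSector (n : ℕ) (s : Fin 2 × Fin 2) :
    Submodule ℂ (EuclideanSpace ℂ (Fin (2 * n) → Fin 2)) :=
  jointEigenspace (xzGenerators n) ![(-1) ^ (s.1 : ℕ), (-1) ^ (s.2 : ℕ)]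

/-- `π` consists of `{i}`, `{j}` and pairs of the other qubits. -/
def PairsAllBut {m : ℕ} (π : Finpartition (Finset.univ : Finset (Fin m))) (i j : Fin m) : Prop :=
  {i} ∈ π.parts ∧ {j} ∈ π.parts ∧ ∀ T ∈ π.parts, T ≠ {i} → T ≠ {j} → T.card = 2

end

/-! On an even number of qubits the tensor powers of the Weyl operators `weyl t`, `t ∈ (ℤ/2)²`,
multiply without signs, so they form a commuting group isomorphic to `(ℤ/2)²`. Its characters are
the maps `sympSign r`, and the character sum `stabOp r` is four times the projector onto a
simultaneous eigenspace (`stabOp_mul_stabOp`, `mem_xzSector`). Every state in the theorem is a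
multiple of some `stabOp r`; in particular the Bell projectors are the case of two qubits
(`bellProj_eq_stabOp`). The closed form, the dimensions, permutation invariance, the Bell
decomposition, the Bell measurements and the Smolin recursion then all reduce to orthogonality of
characters (`sum_sympSign_mul`) and to the fact that conjugation by a Pauli matrix on one qubit only
shifts the label `r` (`onFirst_conj_stabOp`).

Entanglement is governed by the partial transpose. Transposition changes only the sign of the
antisymmetric operator `weyl (1, 1)`. Over an even set of qubits it therefore fixes `stabOp r`,
while over one qubit it produces a negative eigenvalue, so the state is not fully separable
(`not_posSemidef_ptrans_stabOp`). Positivity of a partial transpose survives copies, LOCC and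
limits, and no entangled pure state of two parties has it across a cut between them. With at least
four qubits any `i` and `j` are separated by an even cut `{i, k}`, so nothing can be distilled
between them (`not_distillableBetween_of_posSemidef_ptrans`).

When the remaining qubits are grouped in pairs, Bell measurements on these pairs replace their
factors by signs known from the outcomes. A Weyl correction on the qubit `i` removes the signs and
leaves exactly `Φ₀₀`, from a single copy (`PairsAllBut.distillableBetween`). -/

noncomputable section

/-! ### Signs and Weyl operators -/

/-- The sign `(-1)^(a₁ t₂ + a₂ t₁)` by which the Pauli operators `a` and `t` commute. -/
def sympSign (a t : Fin 2 × Fin 2) : ℂ :=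
  (-1) ^ ((a.1 : ℕ) * (t.2 : ℕ) + (a.2 : ℕ) * (t.1 : ℕ))

/-- The Weyl operator `X ^ t₁ Z ^ t₂`. -/
def weyl (t : Fin 2 × Fin 2) : Matrix (Fin 2) (Fin 2) ℂ :=
  Matrix.of fun x y => if x = y + t.1 then (-1) ^ ((t.2 : ℕ) * (y : ℕ)) else 0

theorem weyl_00 : weyl (0, 0) = !![1, 0; 0, 1] := by
  ext x y; fin_cases x <;> fin_cases y <;> simp [weyl]

theorem weyl_01 : weyl (0, 1) = !![1, 0; 0, -1] := by
  ext x y; fin_cases x <;> fin_cases y <;> simp [weyl]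

theorem weyl_10 : weyl (1, 0) = !![0, 1; 1, 0] := by
  ext x y; fin_cases x <;> fin_cases y <;> simp [weyl]

theorem weyl_11 : weyl (1, 1) = !![0, -1; 1, 0] := by
  ext x y; fin_cases x <;> fin_cases y <;> simp [weyl]

theorem weyl_zero : weyl 0 = 1 := by
  rw [Matrix.one_fin_two]; exact weyl_00

@[elab_as_elim]
theorem bits_induction {p : Fin 2 × Fin 2 → Prop} (h00 : p (0, 0)) (h01 : p (0, 1))
    (h10 : p (1, 0)) (h11 : p (1, 1)) (t : Fin 2 × Fin 2) : p t := by
  obtain ⟨a, b⟩ := t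
  fin_cases a <;> fin_cases b <;> assumption

theorem sum_bits {M : Type*} [AddCommMonoid M] (f : Fin 2 × Fin 2 → M) :
    ∑ t, f t = f (0, 0) + f (0, 1) + (f (1, 0) + f (1, 1)) := by
  rw [Fintype.sum_prod_type]; simp

theorem sum_two_bits {M : Type*} [AddCommMonoid M] (f : (Fin 2 → Fin 2) → M) :
    ∑ x, f x = f ![0, 0] + f ![0, 1] + (f ![1, 0] + f ![1, 1]) := by
  rw [← (finTwoArrowEquiv (Fin 2)).symm.sum_comp, sum_bits]; rfl

theorem sympSign_zero (t : Fin 2 × Fin 2) : sympSign 0 t = 1 := by simp [sympSign]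

theorem sympSign_comm (a t : Fin 2 × Fin 2) : sympSign a t = sympSign t a := by
  simp only [sympSign]; ring

theorem sympSign_add (a b t : Fin 2 × Fin 2) :
    sympSign (a + b) t = sympSign a t * sympSign b t := by
  induction a using bits_induction <;> induction b using bits_induction <;>
    induction t using bits_induction <;> simp [sympSign]

theorem sympSign_mul_self (a t : Fin 2 × Fin 2) : sympSign a t * sympSign a t = 1 := by
  simp only [sympSign, ← pow_add, ← two_mul, pow_mul]; simp

theorem star_sympSign (a t : Fin 2 × Fin 2) : star (sympSign a t) = sympSign a t := by
  simp [sympSign]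

theorem sympSign_sum {κ : Type*} (s : Finset κ) (a : κ → Fin 2 × Fin 2) (t : Fin 2 × Fin 2) :
    sympSign (∑ k ∈ s, a k) t = ∏ k ∈ s, sympSign (a k) t := by
  classical
  induction s using Finset.induction_on with
  | empty => simp [sympSign_zero]
  | insert k s hk ih => rw [Finset.sum_insert hk, Finset.prod_insert hk, sympSign_add, ih]

theorem sum_sympSign (a : Fin 2 × Fin 2) : ∑ t, sympSign a t = if a = 0 then 4 else 0 := by
  rw [sum_bits]
  induction a using bits_induction <;> simp [sympSign, Prod.ext_iff]
  all_goals norm_num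

/-- Orthogonality of the characters of `(ℤ/2)²`: the product of two characters is the character of
`a + b`, and `a + b = 0` means `a = b` in characteristic two. -/
theorem sum_sympSign_mul (a b : Fin 2 × Fin 2) :
    ∑ t, sympSign t a * sympSign t b = if a = b then 4 else 0 := by
  have h : ∀ t, sympSign t a * sympSign t b = sympSign (a + b) t := fun t => by
    rw [sympSign_add, sympSign_comm t a, sympSign_comm t b]
  simp only [h, sum_sympSign]
  have h2 : ∀ a b : Fin 2 × Fin 2, a + b = 0 ↔ a = b := by decide
  simp only [h2]

theorem weyl_mul_conjTranspose (r : Fin 2 × Fin 2) : weyl r * (weyl r)ᴴ = 1 := by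
  induction r using bits_induction <;>
    simp only [weyl_00, weyl_01, weyl_10, weyl_11] <;> ext x y <;>
    fin_cases x <;> fin_cases y <;> simp [Matrix.mul_apply]

theorem conjTranspose_mul_weyl (r : Fin 2 × Fin 2) : (weyl r)ᴴ * weyl r = 1 :=
  mul_eq_one_comm.1 (weyl_mul_conjTranspose r)

theorem weyl_conj (r t : Fin 2 × Fin 2) :
    weyl r * weyl t * (weyl r)ᴴ = sympSign r t • weyl t := by
  induction r using bits_induction <;> induction t using bits_induction <;>
    simp only [weyl_00, weyl_01, weyl_10, weyl_11] <;> ext x y <;>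
    fin_cases x <;> fin_cases y <;> simp [Matrix.mul_apply, sympSign]

theorem weyl_mul (r t : Fin 2 × Fin 2) :
    weyl r * weyl t = (-1 : ℂ) ^ ((r.2 : ℕ) * (t.1 : ℕ)) • weyl (r + t) := by
  induction r using bits_induction <;> induction t using bits_induction <;>
    simp [weyl_00, weyl_01, weyl_10, weyl_11]

theorem weyl_conjTranspose (t : Fin 2 × Fin 2) :
    (weyl t)ᴴ = (-1 : ℂ) ^ ((t.1 : ℕ) * (t.2 : ℕ)) • weyl t := by
  induction t using bits_induction <;>
    simp only [weyl_00, weyl_01, weyl_10, weyl_11] <;> ext x y <;>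
    fin_cases x <;> fin_cases y <;> simp

/-- Only `weyl (1, 1)`, a multiple of `Y`, is antisymmetric. This one sign decides which partial
transposes of the states are positive. -/
theorem weyl_transpose (t : Fin 2 × Fin 2) :
    (weyl t)ᵀ = (-1 : ℂ) ^ ((t.1 : ℕ) * (t.2 : ℕ)) • weyl t := by
  induction t using bits_induction <;>
    simp only [weyl_00, weyl_01, weyl_10, weyl_11] <;> ext x y <;>
    fin_cases x <;> fin_cases y <;> simp

theorem trace_weyl (t : Fin 2 × Fin 2) : (weyl t).trace = if t = 0 then 2 else 0 := by
  induction t using bits_induction <;>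
    simp [weyl_00, weyl_01, weyl_10, weyl_11, Matrix.trace_fin_two, Prod.ext_iff]
  all_goals norm_num

/-- A Pauli matrix is a phase times a Weyl operator. -/
theorem pauli_eq (a b : Fin 2) :
    pauli a b = Complex.I ^ ((a : ℕ) * (b : ℕ)) • weyl (a, b) := by
  fin_cases a <;> fin_cases b <;>
    simp [pauli, weyl_00, weyl_01, weyl_10, weyl_11, Matrix.one_fin_two]

theorem pauli_conj (a b : Fin 2) (t : Fin 2 × Fin 2) :
    pauli a b * weyl t * (pauli a b)ᴴ = sympSign (a, b) t • weyl t := by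
  have h : star (Complex.I ^ ((a : ℕ) * (b : ℕ))) * Complex.I ^ ((a : ℕ) * (b : ℕ)) = 1 := by
    rw [star_pow, ← mul_pow]; simp
  rw [pauli_eq, Matrix.conjTranspose_smul, Matrix.smul_mul, Matrix.smul_mul, Matrix.mul_smul,
    smul_smul, mul_comm, h, one_smul, weyl_conj]

/-! ### Bell vectors -/

theorem sqrt_two_inv_mul_self :
    ((Real.sqrt 2 : ℂ))⁻¹ * ((Real.sqrt 2 : ℂ))⁻¹ = 1 / 2 := by
  rw [← mul_inv, ← Complex.ofReal_mul, Real.mul_self_sqrt (by norm_num)]; norm_num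

/-- A Bell state is the stabilizer state of `X ⊗ X` and `Z ⊗ Z` with signs given by its label; the
identity is a check of all matrix entries. -/
theorem bellProj_eq (a : Fin 2 × Fin 2) (x y : Fin 2 → Fin 2) :
    bellProj a.1 a.2 x y =
      1 / 4 * ∑ t, sympSign a t * (weyl t (x 0) (y 0) * weyl t (x 1) (y 1)) := by
  have key : ∀ x0 x1 y0 y1 : Fin 2, bellProj a.1 a.2 ![x0, x1] ![y0, y1] =
      1 / 4 * ∑ t, sympSign a t * (weyl t x0 y0 * weyl t x1 y1) := by
    intro x0 x1 y0 y1
    rw [sum_bits, weyl_00, weyl_01, weyl_10, weyl_11]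
    induction a using bits_induction <;> fin_cases x0 <;> fin_cases x1 <;> fin_cases y0 <;>
      fin_cases y1 <;> simp [bellProj, bell, sympSign, div_eq_mul_inv, sqrt_two_inv_mul_self] <;>
      norm_num
  have hx : x = ![x 0, x 1] := by ext i; fin_cases i <;> rfl
  have hy : y = ![y 0, y 1] := by ext i; fin_cases i <;> rfl
  rw [hx, hy, key]; rfl

/-- The spectral decomposition of `weyl t ⊗ weyl t`. -/
theorem weyl_mul_weyl_eq (t : Fin 2 × Fin 2) (x y : Fin 2 → Fin 2) :
    weyl t (x 0) (y 0) * weyl t (x 1) (y 1) = ∑ a, sympSign a t * bellProj a.1 a.2 x y := by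
  simp only [bellProj_eq, Finset.mul_sum]
  rw [Finset.sum_comm]
  have h : ∀ u, ∑ a : Fin 2 × Fin 2, sympSign a t * (1 / 4 * (sympSign a u * (weyl u (x 0) (y 0) *
      weyl u (x 1) (y 1)))) = if t = u then weyl u (x 0) (y 0) * weyl u (x 1) (y 1) else 0 := by
    intro u
    have := sum_sympSign_mul t u
    calc _ = 1 / 4 * (∑ a, sympSign a t * sympSign a u) * (weyl u (x 0) (y 0) *
          weyl u (x 1) (y 1)) := by
            rw [Finset.mul_sum, Finset.sum_mul]; exact Finset.sum_congr rfl fun a _ => by ring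
      _ = _ := by rw [this]; split_ifs <;> ring
  exact (by simp : _ = _).trans (Finset.sum_congr rfl fun u _ => (h u).symm)

theorem sum_star_bell_mul_bell (a b : Fin 2 × Fin 2) :
    ∑ x, star (bell a.1 a.2 x) * bell b.1 b.2 x = if a = b then 1 else 0 := by
  rw [sum_two_bits]
  induction a using bits_induction <;> induction b using bits_induction <;>
    simp [bell, div_eq_mul_inv, sqrt_two_inv_mul_self] <;> norm_num

theorem sum_bell_mul_star_bell (x y : Fin 2 → Fin 2) :
    ∑ a : Fin 2 × Fin 2, bell a.1 a.2 x * star (bell a.1 a.2 y) = if x = y then 1 else 0 := by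
  have h := weyl_mul_weyl_eq 0 x y
  simp only [sympSign_comm _ 0, sympSign_zero, one_mul, weyl_zero, Matrix.one_apply] at h
  rw [show (∑ a : Fin 2 × Fin 2, bell a.1 a.2 x * star (bell a.1 a.2 y)) =
    ∑ a : Fin 2 × Fin 2, bellProj a.1 a.2 x y from rfl, ← h]
  by_cases h0 : x 0 = y 0 <;> by_cases h1 : x 1 = y 1 <;>
    simp [funext_iff, Fin.forall_fin_two, h0, h1]

/-- The expectation value of `weyl t ⊗ weyl t` in a Bell state. -/
theorem bell_expectation (a t : Fin 2 × Fin 2) :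
    ∑ x, ∑ y, star (bell a.1 a.2 x) * (weyl t (x 0) (y 0) * weyl t (x 1) (y 1)) *
      bell a.1 a.2 y = sympSign a t := by
  have h : ∀ x y, star (bell a.1 a.2 x) * (weyl t (x 0) (y 0) * weyl t (x 1) (y 1)) *
      bell a.1 a.2 y = ∑ b : Fin 2 × Fin 2, sympSign b t *
        ((star (bell a.1 a.2 x) * bell b.1 b.2 x) * (star (bell b.1 b.2 y) * bell a.1 a.2 y)) := by
    intro x y
    rw [weyl_mul_weyl_eq, Finset.mul_sum, Finset.sum_mul]
    refine Finset.sum_congr rfl fun b _ => ?_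
    simp only [bellProj, Matrix.of_apply]; ring
  calc _ = ∑ b : Fin 2 × Fin 2, sympSign b t * ((∑ x, star (bell a.1 a.2 x) * bell b.1 b.2 x) *
        ∑ y, star (bell b.1 b.2 y) * bell a.1 a.2 y) := by
          simp only [h, Finset.sum_mul_sum]
          simp only [Finset.mul_sum]
          rw [Finset.sum_comm' (t' := Finset.univ) (s' := fun _ => Finset.univ) (by simp)]
          refine (Finset.sum_congr rfl fun y _ => Finset.sum_comm).trans ?_
          rw [Finset.sum_comm]
          refine Finset.sum_congr rfl fun b _ => Finset.sum_comm
    _ = _ := by simp only [sum_star_bell_mul_bell]; simp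

/-! ### Tensor products of local matrices -/

section PiTensor

variable {P : Type} [Fintype P] {H L M : P → Type}

theorem piTensor_apply (A : ∀ p, Matrix (L p) (H p) ℂ) (y x) :
    piTensor A y x = ∏ p, A p (y p) (x p) := rfl

theorem piTensor_mul [DecidableEq P] [∀ p, Fintype (L p)] (A : ∀ p, Matrix (M p) (L p) ℂ)
    (B : ∀ p, Matrix (L p) (H p) ℂ) :
    piTensor A * piTensor B = piTensor fun p => A p * B p := by
  ext y x
  simp only [Matrix.mul_apply, piTensor_apply, Fintype.prod_sum, Finset.prod_mul_distrib]

theorem piTensor_conjTranspose (A : ∀ p, Matrix (L p) (H p) ℂ) :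
    (piTensor A)ᴴ = piTensor fun p => (A p)ᴴ := by
  ext y x
  simp [piTensor_apply]

theorem piTensor_smul (c : P → ℂ) (A : ∀ p, Matrix (L p) (H p) ℂ) :
    (piTensor fun p => c p • A p) = (∏ p, c p) • piTensor A := by
  ext y x
  simp [piTensor_apply, Finset.prod_mul_distrib]

theorem piTensor_one [∀ p, DecidableEq (H p)] [DecidableEq (∀ p, H p)] :
    (piTensor fun p => (1 : Matrix (H p) (H p) ℂ)) = 1 := by
  ext y x
  simp only [piTensor_apply, Matrix.one_apply, Finset.prod_ite_zero, Finset.prod_const_one,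
    Finset.mem_univ, forall_const, funext_iff]

theorem trace_piTensor [DecidableEq P] [∀ p, Fintype (H p)] (A : ∀ p, Matrix (H p) (H p) ℂ) :
    (piTensor A).trace = ∏ p, (A p).trace := by
  simp [Matrix.trace, piTensor_apply, Fintype.prod_sum]

open scoped MatrixOrder Matrix.Norms.L2Operator in
theorem posSemidef_piTensor [DecidableEq P] [∀ p, Fintype (H p)] {A : ∀ p, Matrix (H p) (H p) ℂ}
    (hA : ∀ p, (A p).PosSemidef) : (piTensor A).PosSemidef := by
  classical
  have h : ∀ p, ∃ B : Matrix (H p) (H p) ℂ, A p = Bᴴ * B := fun p =>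
    CStarAlgebra.nonneg_iff_eq_star_mul_self.1 (hA p).nonneg
  choose B hB using h
  rw [show A = fun p => (B p)ᴴ * B p from funext hB, ← piTensor_mul, ← piTensor_conjTranspose]
  exact Matrix.posSemidef_conjTranspose_mul_self _

/-- Conjugation of a tensor product by a tensor product acts factor by factor. -/
theorem piTensor_conj [DecidableEq P] [∀ p, Fintype (H p)] (K : ∀ p, Matrix (L p) (H p) ℂ)
    (A : ∀ p, Matrix (H p) (H p) ℂ) :
    piTensor K * piTensor A * (piTensor K)ᴴ = piTensor fun p => K p * A p * (K p)ᴴ := by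
  rw [piTensor_conjTranspose, piTensor_mul, piTensor_mul]

end PiTensor

/-! ### The group generated by `X^{⊗ ι}` and `Z^{⊗ ι}` -/

/-- The tensor power `(X ^ t₁ Z ^ t₂)^{⊗ ι}`. -/
def weylPow (ι : Type) [Fintype ι] (t : Fin 2 × Fin 2) : QubitOp ι :=
  piTensor fun _ => weyl t

/-- The signed sum over the group generated by `X^{⊗ ι}` and `Z^{⊗ ι}`. -/
def stabOp (ι : Type) [Fintype ι] (r : Fin 2 × Fin 2) : QubitOp ι :=
  ∑ t, sympSign r t • weylPow ι t

section Stab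

variable {ι : Type} [Fintype ι]

theorem stabOp_apply (r : Fin 2 × Fin 2) (x y : ι → Fin 2) :
    stabOp ι r x y = ∑ t, sympSign r t * ∏ i, weyl t (x i) (y i) := by
  simp [stabOp, weylPow, Matrix.sum_apply, piTensor_apply]

theorem bellProj_eq_stabOp (a : Fin 2 × Fin 2) :
    bellProj a.1 a.2 = (1 / 4 : ℂ) • stabOp (Fin 2) a := by
  ext x y
  simp [bellProj_eq, stabOp_apply, Fin.prod_univ_two]

theorem stabOp_submatrix_equiv {κ : Type} [Fintype κ] (e : κ ≃ ι) (r : Fin 2 × Fin 2) :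
    (stabOp ι r).submatrix (fun x => x ∘ e.symm) (fun x => x ∘ e.symm) = stabOp κ r := by
  ext x y
  simp only [Matrix.submatrix_apply, stabOp_apply, Function.comp]
  refine Finset.sum_congr rfl fun t _ => ?_
  rw [e.symm.prod_comp (fun i => weyl t (x i) (y i))]

/-- Each sign in the multiplication and adjoint rules of the Weyl operators occurs once per qubit,
so an even number of qubits cancels it. -/
theorem neg_one_pow_pow_even (m : ℕ) (h : Even (Fintype.card ι)) :
    ((-1 : ℂ) ^ m) ^ Fintype.card ι = 1 := by
  rw [← pow_mul, mul_comm, pow_mul, h.neg_one_pow, one_pow]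

theorem weylPow_zero : weylPow ι 0 = 1 := by
  simp only [weylPow, weyl_zero]; exact piTensor_one

theorem weylPow_conjTranspose (h : Even (Fintype.card ι)) (t : Fin 2 × Fin 2) :
    (weylPow ι t)ᴴ = weylPow ι t := by
  simp only [weylPow, piTensor_conjTranspose, weyl_conjTranspose, piTensor_smul,
    Finset.prod_const, Finset.card_univ, neg_one_pow_pow_even _ h, one_smul]

theorem stabOp_conjTranspose (h : Even (Fintype.card ι)) (r : Fin 2 × Fin 2) :
    (stabOp ι r)ᴴ = stabOp ι r := by
  simp only [stabOp, Matrix.conjTranspose_sum, Matrix.conjTranspose_smul,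
    weylPow_conjTranspose h, star_sympSign]

theorem sum_stabOp : ∑ r, stabOp ι r = (4 : ℂ) • 1 := by
  simp only [stabOp]
  rw [Finset.sum_comm]
  simp only [← Finset.sum_smul, sympSign_comm _, sum_sympSign]
  simp [weylPow_zero]

variable [DecidableEq ι]

theorem weylPow_mul (h : Even (Fintype.card ι)) (r t : Fin 2 × Fin 2) :
    weylPow ι r * weylPow ι t = weylPow ι (r + t) := by
  simp only [weylPow, piTensor_mul, weyl_mul, piTensor_smul, Finset.prod_const, Finset.card_univ,
    neg_one_pow_pow_even _ h, one_smul]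

/-- Multiplication by a group element permutes the terms of the character sum, at the cost of the
value of the character there. -/
theorem weylPow_mul_stabOp (h : Even (Fintype.card ι)) (u r : Fin 2 × Fin 2) :
    weylPow ι u * stabOp ι r = sympSign r u • stabOp ι r := by
  simp only [stabOp, Finset.mul_sum, Matrix.mul_smul, weylPow_mul h, Finset.smul_sum, smul_smul]
  refine Fintype.sum_equiv (Equiv.addLeft u) _ _ fun t => ?_
  rw [Equiv.coe_addLeft, sympSign_comm r (u + t), sympSign_add, ← mul_assoc, sympSign_comm r u,
    sympSign_mul_self, one_mul, sympSign_comm t]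

theorem stabOp_mul_stabOp (h : Even (Fintype.card ι)) (r s : Fin 2 × Fin 2) :
    stabOp ι r * stabOp ι s = (if r = s then 4 else 0 : ℂ) • stabOp ι s := by
  rw [stabOp, Finset.sum_mul]
  simp only [Matrix.smul_mul, weylPow_mul_stabOp h, smul_smul, ← Finset.sum_smul]
  congr 1
  rw [← sum_sympSign_mul]
  exact Finset.sum_congr rfl fun t _ => by rw [sympSign_comm r, sympSign_comm s]

theorem posSemidef_stabOp (h : Even (Fintype.card ι)) (r : Fin 2 × Fin 2) :
    (stabOp ι r).PosSemidef := by
  have h4 : stabOp ι r = (1 / 4 : ℂ) • ((stabOp ι r)ᴴ * stabOp ι r) := by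
    rw [stabOp_conjTranspose h, stabOp_mul_stabOp h, if_pos rfl, smul_smul]; norm_num
  rw [h4]
  exact (Matrix.posSemidef_conjTranspose_mul_self _).smul (by positivity)

theorem trace_weylPow [Nonempty ι] (t : Fin 2 × Fin 2) :
    (weylPow ι t).trace = if t = 0 then 2 ^ Fintype.card ι else 0 := by
  simp only [weylPow, trace_piTensor, trace_weyl, Finset.prod_const, Finset.card_univ]
  split_ifs
  · rfl
  · exact zero_pow Fintype.card_ne_zero

theorem trace_stabOp [Nonempty ι] (r : Fin 2 × Fin 2) :
    (stabOp ι r).trace = 2 ^ Fintype.card ι := by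
  simp [stabOp, Matrix.trace_sum, trace_weylPow, sympSign_comm r, sympSign_zero]

theorem stabOp_eq_mul (h : Even (Fintype.card ι)) (r : Fin 2 × Fin 2) :
    stabOp ι r = (1 + sympSign r (1, 0) • weylPow ι (1, 0)) *
      (1 + sympSign r (0, 1) • weylPow ι (0, 1)) := by
  have h0 : weylPow ι (0, 0) = 1 := weylPow_zero
  have h1 : sympSign r (0, 0) = 1 := by rw [sympSign_comm]; exact sympSign_zero r
  have h2 : sympSign r (1, 1) = sympSign r (1, 0) * sympSign r (0, 1) := by
    rw [sympSign_comm r, sympSign_comm r, sympSign_comm r, ← sympSign_add]; rfl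
  rw [stabOp, sum_bits, h0, h1, h2, add_mul, mul_add, mul_add, one_mul, one_mul, mul_one,
    Matrix.smul_mul, Matrix.mul_smul, weylPow_mul h, smul_smul, one_smul,
    show ((1, 0) + (0, 1) : Fin 2 × Fin 2) = (1, 1) from rfl]

end Stab

/-! ### Projectors and the maximally mixed state of a subspace -/

section MaxMixed

variable {ι : Type} [Fintype ι] [DecidableEq ι]

theorem isProj_toEuclideanLin {V : Submodule ℂ (EuclideanSpace ℂ (ι → Fin 2))} {A : QubitOp ι}
    (hi : A * A = A) (hV : ∀ v, v ∈ V ↔ Matrix.toEuclideanLin A v = v) :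
    LinearMap.IsProj V (Matrix.toEuclideanLin A) := by
  refine ⟨fun v => (hV _).2 ?_, fun v hv => (hV v).1 hv⟩
  conv_rhs => rw [← hi]
  exact (DFunLike.congr_fun (map_mul (Matrix.toEuclideanCLM (n := ι → Fin 2) (𝕜 := ℂ)) A A) v).symm

theorem finrank_eq_trace {V : Submodule ℂ (EuclideanSpace ℂ (ι → Fin 2))} {A : QubitOp ι}
    (hi : A * A = A) (hV : ∀ v, v ∈ V ↔ Matrix.toEuclideanLin A v = v) :
    (Module.finrank ℂ V : ℂ) = A.trace := by
  rw [← (isProj_toEuclideanLin hi hV).trace, Matrix.toEuclideanLin,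
    Matrix.toLpLin_eq_toLin, Matrix.trace_toLin_eq]

/-- A self-adjoint idempotent is the orthogonal projection onto its range, and the range of an
idempotent is its set of fixed vectors. -/
theorem starProjection_eq_toEuclideanCLM {V : Submodule ℂ (EuclideanSpace ℂ (ι → Fin 2))}
    {A : QubitOp ι} (hi : A * A = A) (ha : Aᴴ = A)
    (hV : ∀ v, v ∈ V ↔ Matrix.toEuclideanLin A v = v) :
    V.starProjection = Matrix.toEuclideanCLM (n := ι → Fin 2) (𝕜 := ℂ) A := by
  have hs : IsStarProjection (Matrix.toEuclideanCLM (n := ι → Fin 2) (𝕜 := ℂ) A) :=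
    ⟨by rw [IsIdempotentElem, ← map_mul, hi], by
      rw [IsSelfAdjoint, ← map_star, Matrix.star_eq_conjTranspose, ha]⟩
  obtain ⟨_, h⟩ := isStarProjection_iff_eq_starProjection_range.1 hs
  have hr : (Matrix.toEuclideanCLM (n := ι → Fin 2) (𝕜 := ℂ) A).range = V := by
    ext v
    constructor
    · rintro ⟨w, rfl⟩
      exact (isProj_toEuclideanLin hi hV).map_mem w
    · exact fun hv => ⟨v, (hV v).1 hv⟩
  rw [h]
  simp only [hr]

theorem maxMixed_eq {V : Submodule ℂ (EuclideanSpace ℂ (ι → Fin 2))}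
    {A : QubitOp ι} (hi : A * A = A) (ha : Aᴴ = A)
    (hV : ∀ v, v ∈ V ↔ Matrix.toEuclideanLin A v = v) :
    maxMixed V = A.trace⁻¹ • A := by
  rw [maxMixed, finrank_eq_trace hi hV, starProjection_eq_toEuclideanCLM hi ha hV,
    StarAlgEquiv.symm_apply_apply]

end MaxMixed

/-! ### The simultaneous eigenspaces of `X^{⊗ 2n}` and `Z^{⊗ 2n}` -/

theorem even_card_fin_two_mul (n : ℕ) : Even (Fintype.card (Fin (2 * n))) := by simp

theorem pauli_X : pauli 1 0 = weyl (1, 0) := by simp [pauli_eq]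

theorem pauli_Z : pauli 0 1 = weyl (0, 1) := by simp [pauli_eq]

theorem quarter_stabOp_mul_self {ι : Type} [Fintype ι] [DecidableEq ι]
    (h : Even (Fintype.card ι)) (r : Fin 2 × Fin 2) :
    ((1 / 4 : ℂ) • stabOp ι r) * ((1 / 4 : ℂ) • stabOp ι r) = (1 / 4 : ℂ) • stabOp ι r := by
  rw [Matrix.smul_mul, Matrix.mul_smul, stabOp_mul_stabOp h, if_pos rfl, smul_smul, smul_smul]
  norm_num

theorem quarter_stabOp_conjTranspose {ι : Type} [Fintype ι]
    (h : Even (Fintype.card ι)) (r : Fin 2 × Fin 2) :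
    ((1 / 4 : ℂ) • stabOp ι r)ᴴ = (1 / 4 : ℂ) • stabOp ι r := by
  rw [Matrix.conjTranspose_smul, stabOp_conjTranspose h]; simp

/-- The label is swapped because the symplectic form pairs `X` with the `Z`-component: the
eigenvalue of `X^{⊗ 2n}` on the range of `stabOp r` is `(-1) ^ r.2`, that of `Z^{⊗ 2n}` is `(-1) ^
r.1`. -/
theorem mem_xzSector (n : ℕ) (s : Fin 2 × Fin 2) (v : EuclideanSpace ℂ (Fin (2 * n) → Fin 2)) :
    v ∈ xzSector n s ↔
      Matrix.toEuclideanLin ((1 / 4 : ℂ) • stabOp (Fin (2 * n)) s.swap) v = v := by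
  have he := even_card_fin_two_mul n
  have hmul : ∀ (A B : QubitOp (Fin (2 * n))) w, Matrix.toEuclideanLin (A * B) w =
      Matrix.toEuclideanLin A (Matrix.toEuclideanLin B w) := fun A B w =>
    DFunLike.congr_fun
      (map_mul (Matrix.toEuclideanCLM (n := Fin (2 * n) → Fin 2) (𝕜 := ℂ)) A B) w
  have hs1 : sympSign s.swap (1, 0) = (-1) ^ (s.1 : ℕ) := by simp [sympSign]
  have hs2 : sympSign s.swap (0, 1) = (-1) ^ (s.2 : ℕ) := by simp [sympSign]
  have hmem : v ∈ xzSector n s ↔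
      Matrix.toEuclideanLin (weylPow (Fin (2 * n)) (1, 0)) v = sympSign s.swap (1, 0) • v ∧
      Matrix.toEuclideanLin (weylPow (Fin (2 * n)) (0, 1)) v = sympSign s.swap (0, 1) • v := by
    simp only [xzSector, jointEigenspace, Submodule.mem_iInf, Fin.forall_fin_two,
      Module.End.mem_eigenspace_iff, xzGenerators, allQubits, pauli_X, pauli_Z, hs1, hs2]
    rfl
  rw [hmem]
  constructor
  · rintro ⟨h1, h2⟩
    -- On a joint eigenvector each factor `1 + sign • generator` acts as `2`, which cancels the `1 /
    -- 4`.
    rw [stabOp_eq_mul he, map_smul, LinearMap.smul_apply, hmul]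
    simp only [map_add, map_smul, LinearMap.add_apply, LinearMap.smul_apply, h1, h2,
      Matrix.toLpLin_one, LinearMap.id_apply, smul_smul, sympSign_mul_self, one_smul]
    rw [← two_smul ℂ (v + v), ← two_smul ℂ v, smul_smul, smul_smul]
    norm_num
  · intro h
    have hu : ∀ u, Matrix.toEuclideanLin (weylPow (Fin (2 * n)) u) v = sympSign s.swap u • v := by
      intro u
      conv_lhs => rw [← h]
      rw [← hmul, Matrix.mul_smul, weylPow_mul_stabOp he, smul_comm, map_smul,
        LinearMap.smul_apply, h]
    exact ⟨hu _, hu _⟩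

theorem trace_quarter_stabOp {n : ℕ} (hn : 1 ≤ n) (r : Fin 2 × Fin 2) :
    ((1 / 4 : ℂ) • stabOp (Fin (2 * n)) r).trace = 4 ^ (n - 1) := by
  have : Nonempty (Fin (2 * n)) := ⟨⟨0, by omega⟩⟩
  obtain ⟨m, rfl⟩ : ∃ m, n = m + 1 := ⟨n - 1, by omega⟩
  rw [Matrix.trace_smul, trace_stabOp, Fintype.card_fin, pow_mul, pow_succ, Nat.add_sub_cancel, smul_eq_mul]
  ring

theorem maxMixed_xzSector {n : ℕ} (hn : 1 ≤ n) (s : Fin 2 × Fin 2) :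
    maxMixed (xzSector n s) = (1 / 4 ^ n : ℂ) • stabOp (Fin (2 * n)) s.swap := by
  have he := even_card_fin_two_mul n
  rw [maxMixed_eq (quarter_stabOp_mul_self he _) (quarter_stabOp_conjTranspose he _)
    (mem_xzSector n s), trace_quarter_stabOp hn, smul_smul]
  obtain ⟨m, rfl⟩ : ∃ m, n = m + 1 := ⟨n - 1, by omega⟩
  congr 1
  rw [Nat.add_sub_cancel, pow_succ]
  field_simp

theorem finrank_xzSector {n : ℕ} (hn : 1 ≤ n) (s : Fin 2 × Fin 2) :
    Module.finrank ℂ (xzSector n s) = 4 ^ (n - 1) := by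
  have h := finrank_eq_trace (quarter_stabOp_mul_self (even_card_fin_two_mul n) s.swap)
    (mem_xzSector n s)
  rw [trace_quarter_stabOp hn] at h
  exact_mod_cast h

theorem xzState_eq_maxMixed (n : ℕ) : xzState n = maxMixed (xzSector n (0, 0)) := by
  rw [xzState, xzSector]
  congr 2
  ext k
  fin_cases k <;> simp

theorem xzState_eq {n : ℕ} (hn : 1 ≤ n) :
    xzState n = (1 / 4 ^ n : ℂ) • stabOp (Fin (2 * n)) 0 := by
  rw [xzState_eq_maxMixed, maxMixed_xzSector hn]; rfl

theorem orthogonalFamily_xzSector (n : ℕ) :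
    OrthogonalFamily ℂ (fun s => xzSector n s) (fun s => (xzSector n s).subtypeₗᵢ) := by
  have he := even_card_fin_two_mul n
  intro s s' hss v w
  have hv := (mem_xzSector n s v).1 v.2
  have hw := (mem_xzSector n s' w).1 w.2
  set A := (1 / 4 : ℂ) • stabOp (Fin (2 * n)) s.swap with hA
  set B := (1 / 4 : ℂ) • stabOp (Fin (2 * n)) s'.swap with hB
  have hAB : A * B = 0 := by
    rw [hA, hB, Matrix.smul_mul, Matrix.mul_smul, stabOp_mul_stabOp he,
      if_neg (Prod.swap_injective.ne hss)]
    simp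
  have hadj : ContinuousLinearMap.adjoint
      (Matrix.toEuclideanCLM (n := Fin (2 * n) → Fin 2) (𝕜 := ℂ) A) =
        Matrix.toEuclideanCLM (n := Fin (2 * n) → Fin 2) (𝕜 := ℂ) A := by
    rw [← ContinuousLinearMap.star_eq_adjoint, ← map_star, Matrix.star_eq_conjTranspose,
      quarter_stabOp_conjTranspose he]
  change inner ℂ (v : EuclideanSpace ℂ (Fin (2 * n) → Fin 2)) w = 0
  rw [← hv, ← hw, ← Matrix.coe_toEuclideanCLM_eq_toEuclideanLin,
    ← Matrix.coe_toEuclideanCLM_eq_toEuclideanLin, ContinuousLinearMap.coe_coe,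
    ContinuousLinearMap.coe_coe, ← hadj, ContinuousLinearMap.adjoint_inner_left,
    ← mul_apply_eq_comp, ← map_mul, hAB]
  simp

theorem iSup_xzSector (n : ℕ) : (⨆ s, xzSector n s) = ⊤ := by
  have he := even_card_fin_two_mul n
  rw [eq_top_iff]
  intro v _
  have h1 : v = ∑ r, Matrix.toEuclideanLin ((1 / 4 : ℂ) • stabOp (Fin (2 * n)) r) v := by
    rw [← LinearMap.sum_apply, ← map_sum, ← Finset.smul_sum, sum_stabOp, smul_smul]
    simp
  rw [h1]
  refine Submodule.sum_mem _ fun r _ => ?_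
  exact Submodule.mem_iSup_of_mem r.swap
    ((isProj_toEuclideanLin (quarter_stabOp_mul_self he _) (mem_xzSector n r.swap)).map_mem v)

/-! ### Permutations, Bell decompositions, Bell measurements -/

theorem xzState_submatrix_perm {n : ℕ} (hn : 1 ≤ n) (τ : Equiv.Perm (Fin (2 * n))) :
    (xzState n).submatrix (fun x => x ∘ τ) (fun x => x ∘ τ) = xzState n := by
  rw [xzState_eq hn]
  have := stabOp_submatrix_equiv τ.symm 0
  rw [Matrix.submatrix_smul, Pi.smul_apply, Pi.smul_apply]
  rw [Equiv.symm_symm] at this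
  rw [this]

/-- The product over all the qubits, arranged in pairs. -/
theorem prod_pairs {K ι : Type} [Fintype K] [Fintype ι] (e : K × Fin 2 ≃ ι) (f : ι → ℂ) :
    ∏ i, f i = ∏ k, f (e (k, 0)) * f (e (k, 1)) := by
  rw [← e.prod_comp, Fintype.prod_prod_type]
  simp [Fin.prod_univ_two]

/-- The parity constraints are detected by averaging over all characters; the average factors over
the pairs. -/
theorem sum_sum_eq_zero_indicator {K : Type} [Fintype K] (α β : K → Fin 2) :
    (if ∑ i, α i = 0 ∧ ∑ i, β i = 0 then (1 : ℂ) else 0) =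
      1 / 4 * ∑ t, ∏ i, sympSign (α i, β i) t := by
  have h : ∀ t, ∏ i, sympSign (α i, β i) t = sympSign (∑ i, α i, ∑ i, β i) t := by
    intro t
    rw [← sympSign_sum]
    congr 1
    rw [Prod.ext_iff, Prod.fst_sum, Prod.snd_sum]
    exact ⟨rfl, rfl⟩
  simp only [h, sum_sympSign, Prod.mk_eq_zero]
  split_ifs <;> norm_num

/-- The Bell decomposition for an arbitrary arrangement of the qubits in pairs. -/
theorem stabOp_eq_sum_bellProj {K ι : Type} [Fintype K] [DecidableEq K] [Fintype ι]
    (e : K × Fin 2 ≃ ι) (x y : ι → Fin 2) :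
    stabOp ι 0 x y = 4 * ∑ α : K → Fin 2, ∑ β : K → Fin 2,
      if ∑ i, α i = 0 ∧ ∑ i, β i = 0 then
        ∏ i, bellProj (α i) (β i) (fun j => x (e (i, j))) (fun j => y (e (i, j))) else 0 := by
  have h1 : ∀ t, ∏ i, weyl t (x i) (y i) = ∑ α : K → Fin 2, ∑ β : K → Fin 2,
      (∏ i, sympSign (α i, β i) t) *
        ∏ i, bellProj (α i) (β i) (fun j => x (e (i, j))) (fun j => y (e (i, j))) := by
    intro t
    rw [prod_pairs e]
    have h2 : ∀ k, weyl t (x (e (k, 0))) (y (e (k, 0))) * weyl t (x (e (k, 1))) (y (e (k, 1))) =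
        ∑ a, ∑ b, sympSign (a, b) t *
          bellProj a b (fun j => x (e (k, j))) (fun j => y (e (k, j))) := fun k => by
      rw [weyl_mul_weyl_eq t (fun j => x (e (k, j))) (fun j => y (e (k, j))),
        Fintype.sum_prod_type]
    simp only [h2, Fintype.prod_sum, ← Finset.prod_mul_distrib]
  simp only [stabOp_apply, sympSign_zero, one_mul, h1]
  rw [Finset.sum_comm, Finset.mul_sum]
  refine Finset.sum_congr rfl fun α _ => ?_
  rw [Finset.sum_comm, Finset.mul_sum]
  refine Finset.sum_congr rfl fun β _ => ?_
  rw [← Finset.sum_mul, ← mul_boole, sum_sum_eq_zero_indicator]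
  ring

theorem xzState_eq_sum_pairTensor {n : ℕ} (hn : 1 ≤ n) (e : Fin n × Fin 2 ≃ Fin (2 * n)) :
    xzState n = (1 / 4 ^ (n - 1) : ℂ) •
      ∑ α : Fin n → Fin 2, ∑ β : Fin n → Fin 2,
        if ∑ i, α i = 0 ∧ ∑ i, β i = 0 then
          pairTensor e (fun i => bellProj (α i) (β i))
        else 0 := by
  ext x y
  rw [xzState_eq hn, Matrix.smul_apply, stabOp_eq_sum_bellProj e, Matrix.smul_apply,
    Matrix.sum_apply, smul_eq_mul, smul_eq_mul, ← mul_assoc]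
  obtain ⟨m, rfl⟩ : ∃ m, n = m + 1 := ⟨n - 1, by omega⟩
  congr 1
  · rw [Nat.add_sub_cancel, pow_succ]
    field_simp
  · refine Finset.sum_congr rfl fun α _ => ?_
    rw [Matrix.sum_apply]
    refine Finset.sum_congr rfl fun β _ => ?_
    split_ifs <;> rfl

/-- Both the measurement and the Weyl powers factor over the pairs. A measured pair contributes the
expectation of `weyl t ⊗ weyl t` in its Bell state, a sign, and these signs add up to the new label
of the pair `k`. -/
theorem bellMeasurement_conj_stabOp {n : ℕ} (e : Fin n × Fin 2 ≃ Fin (2 * n)) (k : Fin n)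
    (α β : Fin n → Fin 2) :
    bellMeasurement e k α β * stabOp (Fin (2 * n)) 0 * (bellMeasurement e k α β)ᴴ =
      stabOp (Fin 2) (∑ i ∈ Finset.univ.erase k, (α i, β i)) := by
  ext w w'
  -- Row `w` of the measurement as a tensor product of row vectors: `⟨w|` on the pair `k`, a Bell
  -- bra on each other pair.
  let m : (Fin 2 → Fin 2) → ∀ _ : Fin n, Matrix Unit (Fin 2 → Fin 2) ℂ := fun w i =>
    Matrix.of fun _ u => if i = k then (if w = u then 1 else 0) else star (bell (α i) (β i) u)
  let A : Fin 2 × Fin 2 → ∀ _ : Fin n, Matrix (Fin 2 → Fin 2) (Fin 2 → Fin 2) ℂ := fun t _ =>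
    Matrix.of fun u v => weyl t (u 0) (v 0) * weyl t (u 1) (v 1)
  let E : (Fin (2 * n) → Fin 2) ≃ (Fin n → Fin 2 → Fin 2) :=
    (Equiv.arrowCongr e.symm (Equiv.refl _)).trans (Equiv.curry _ _ _)
  have hE : ∀ x i, E x i = fun j => x (e (i, j)) := fun x i => rfl
  have hm : ∀ w x, bellMeasurement e k α β w x = piTensor (m w) (fun _ => ()) (E x) := by
    intro w x
    rw [piTensor_apply, ← Finset.mul_prod_erase _ _ (Finset.mem_univ k)]
    have h1 : ∀ i ∈ Finset.univ.erase k, m w i () (E x i) =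
        star (bell (α i) (β i) (fun j => x (e (i, j)))) := fun i hi => by
      simp [m, hE, Finset.ne_of_mem_erase hi]
    rw [Finset.prod_congr rfl h1]
    simp [bellMeasurement, m, hE]
  have hW : ∀ t x y, weylPow (Fin (2 * n)) t x y = piTensor (A t) (E x) (E y) := by
    intro t x y
    rw [weylPow, piTensor_apply, prod_pairs e]
    rfl
  have hk : ∀ t, (m w k * A t k * (m w' k)ᴴ) () () = weyl t (w 0) (w' 0) * weyl t (w 1) (w' 1) := by
    intro t
    simp [Matrix.mul_apply, m, A]
  have hi : ∀ t, ∀ i ∈ Finset.univ.erase k, (m w i * A t i * (m w' i)ᴴ) () () =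
      sympSign (α i, β i) t := by
    intro t i hi
    rw [← bell_expectation, Finset.sum_comm]
    simp only [Matrix.mul_apply, m, A, Matrix.of_apply, Finset.ne_of_mem_erase hi, if_false,
      Matrix.conjTranspose_apply, star_star, Finset.sum_mul]
  have key : ∀ t, (bellMeasurement e k α β * weylPow (Fin (2 * n)) t *
      (bellMeasurement e k α β)ᴴ) w w' =
        sympSign (∑ i ∈ Finset.univ.erase k, (α i, β i)) t *
          (weyl t (w 0) (w' 0) * weyl t (w 1) (w' 1)) := by
    intro t
    have h1 : (bellMeasurement e k α β * weylPow (Fin (2 * n)) t *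
        (bellMeasurement e k α β)ᴴ) w w' =
          (piTensor (m w) * piTensor (A t) * (piTensor (m w'))ᴴ) (fun _ => ()) (fun _ => ()) := by
      simp only [Matrix.mul_apply, Matrix.conjTranspose_apply, hm, hW]
      rw [← E.sum_comp]
      exact Finset.sum_congr rfl fun y _ => congrArg (· * _) (E.sum_comp
        (fun x => piTensor (m w) (fun _ => ()) x * piTensor (A t) x (E y)))
    rw [h1, piTensor_conjTranspose, piTensor_mul, piTensor_mul, piTensor_apply,
      ← Finset.mul_prod_erase _ _ (Finset.mem_univ k), hk, Finset.prod_congr rfl (hi t),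
      sympSign_sum, mul_comm]
  simp only [stabOp, Matrix.mul_sum, Matrix.sum_mul, Matrix.sum_apply, Matrix.smul_apply, key,
    sympSign_zero, one_smul, smul_eq_mul]
  refine Finset.sum_congr rfl fun t _ => ?_
  rw [weylPow, piTensor_apply, Fin.prod_univ_two]

theorem bellMeasurement_xzState {n : ℕ} (hn : 1 ≤ n) (e : Fin n × Fin 2 ≃ Fin (2 * n)) (k : Fin n)
    (α β : Fin n → Fin 2) :
    bellMeasurement e k α β * xzState n * (bellMeasurement e k α β)ᴴ =
      (1 / 4 ^ (n - 1) : ℂ) •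
        bellProj (∑ i ∈ Finset.univ.erase k, α i) (∑ i ∈ Finset.univ.erase k, β i) := by
  rw [xzState_eq hn, Matrix.mul_smul, Matrix.smul_mul, bellMeasurement_conj_stabOp]
  have h := bellProj_eq_stabOp (∑ i ∈ Finset.univ.erase k, (α i, β i))
  rw [Prod.fst_sum, Prod.snd_sum] at h
  rw [h, smul_smul]
  obtain ⟨m, rfl⟩ : ∃ m, n = m + 1 := ⟨n - 1, by omega⟩
  congr 1
  rw [Nat.add_sub_cancel, pow_succ]
  field_simp

/-! ### The Smolin recursion -/

theorem onFirst_conj_weylPow {m : ℕ} (hm : 0 < m) (a b : Fin 2) (t : Fin 2 × Fin 2) :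
    onFirst m (pauli a b) * weylPow (Fin m) t * (onFirst m (pauli a b))ᴴ =
      sympSign (a, b) t • weylPow (Fin m) t := by
  rw [onFirst, weylPow, piTensor_conj]
  have h : ∀ i : Fin m, (if (i : ℕ) = 0 then pauli a b else 1) * weyl t *
      (if (i : ℕ) = 0 then pauli a b else 1)ᴴ =
        (if i = ⟨0, hm⟩ then sympSign (a, b) t else 1) • weyl t := by
    intro i
    by_cases hi : i = ⟨0, hm⟩
    · subst hi; simp [pauli_conj]
    · have hi' : (i : ℕ) ≠ 0 := fun h => hi (Fin.ext h)
      simp [hi, hi']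
  simp only [h, piTensor_smul]
  simp

/-- Conjugation multiplies the term of index `t` by the character of `(a, b)` at `t`, and characters
multiply by adding labels. -/
theorem onFirst_conj_stabOp {m : ℕ} (hm : 0 < m) (a b : Fin 2) (r : Fin 2 × Fin 2) :
    onFirst m (pauli a b) * stabOp (Fin m) r * (onFirst m (pauli a b))ᴴ =
      stabOp (Fin m) (r + (a, b)) := by
  simp only [stabOp, Finset.mul_sum, Finset.sum_mul, Matrix.mul_smul, Matrix.smul_mul,
    onFirst_conj_weylPow hm, smul_smul, sympSign_add]

theorem tensorPair_smul_smul {m : ℕ} (c d : ℂ) (A : QubitOp (Fin m)) (B : QubitOp (Fin 2)) :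
    tensorPair (c • A) (d • B) = (c * d) • tensorPair A B := by
  ext x y
  simp only [tensorPair, Matrix.of_apply, Matrix.smul_apply, smul_eq_mul]
  ring

/-- Expanding both factors gives terms `weyl t` on the first qubits and `weyl u` on the last two;
the sum over the common shift leaves only `t = u`. -/
theorem sum_tensorPair_stabOp {m : ℕ} (r s : Fin 2 × Fin 2) :
    ∑ a : Fin 2, ∑ b : Fin 2,
      tensorPair (stabOp (Fin m) (r + (a, b))) (stabOp (Fin 2) (s + (a, b))) =
        (4 : ℂ) • stabOp (Fin (m + 2)) (r + s) := by
  ext x y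
  simp only [Matrix.sum_apply, tensorPair, Matrix.of_apply, stabOp_apply, Matrix.smul_apply]
  rw [← Fintype.sum_prod_type (f := fun a : Fin 2 × Fin 2 =>
    (∑ t, sympSign (r + a) t * ∏ i, weyl t (x (Fin.castAdd 2 i)) (y (Fin.castAdd 2 i))) *
      ∑ t, sympSign (s + a) t * ∏ i, weyl t (x (Fin.natAdd m i)) (y (Fin.natAdd m i)))]
  simp only [Finset.sum_mul_sum]
  rw [Finset.sum_comm, smul_eq_mul, Finset.mul_sum]
  refine Finset.sum_congr rfl fun t _ => ?_
  rw [Finset.sum_comm]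
  have h : ∀ u, ∑ a : Fin 2 × Fin 2,
      sympSign (r + a) t * (∏ i, weyl t (x (Fin.castAdd 2 i)) (y (Fin.castAdd 2 i))) *
        (sympSign (s + a) u * ∏ i, weyl u (x (Fin.natAdd m i)) (y (Fin.natAdd m i))) =
      if t = u then 4 * (sympSign r t * sympSign s u *
        ((∏ i, weyl t (x (Fin.castAdd 2 i)) (y (Fin.castAdd 2 i))) *
          ∏ i, weyl u (x (Fin.natAdd m i)) (y (Fin.natAdd m i)))) else 0 := by
    intro u
    calc _ = (∑ a : Fin 2 × Fin 2, sympSign a t * sympSign a u) * (sympSign r t * sympSign s u *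
        ((∏ i, weyl t (x (Fin.castAdd 2 i)) (y (Fin.castAdd 2 i))) *
          ∏ i, weyl u (x (Fin.natAdd m i)) (y (Fin.natAdd m i)))) := by
            rw [Finset.sum_mul]
            refine Finset.sum_congr rfl fun a _ => ?_
            rw [sympSign_add, sympSign_add]; ring
      _ = _ := by rw [sum_sympSign_mul]; split_ifs <;> ring
  simp only [h, Finset.sum_ite_eq, Finset.mem_univ, if_true]
  rw [sympSign_add, Fin.prod_univ_add]

theorem xzState_succ {m : ℕ} (hm : 1 ≤ m) :
    xzState (m + 1) = (1 / 4 : ℂ) • ∑ α : Fin 2, ∑ β : Fin 2,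
      tensorPair
        (onFirst (2 * m) (pauli α β) * xzState m * (onFirst (2 * m) (pauli α β))ᴴ)
        (bellProj α β) := by
  have hb : ∀ a b : Fin 2, bellProj a b = (1 / 4 : ℂ) • stabOp (Fin 2) (0 + (a, b)) :=
    fun a b => by rw [zero_add]; exact bellProj_eq_stabOp (a, b)
  rw [xzState_eq hm, xzState_eq (Nat.le_succ_of_le hm)]
  simp only [Matrix.mul_smul, Matrix.smul_mul, onFirst_conj_stabOp (show 0 < 2 * m by omega), hb,
    tensorPair_smul_smul, ← Finset.smul_sum]
  rw [sum_tensorPair_stabOp, smul_smul, smul_smul, add_zero]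
  congr 1
  rw [pow_succ]
  field_simp

/-- The singlet has label `(1, 1)`, and each recursion step adds the label of one more singlet. -/
theorem genSmolin_eq (n : ℕ) :
    genSmolin (n + 1) = (1 / 4 ^ (n + 1) : ℂ) •
      stabOp (Fin (2 * (n + 1))) (∑ _i ∈ Finset.range (n + 1), (1, 1)) := by
  have hb : bellProj 1 1 = (1 / 4 : ℂ) • stabOp (Fin 2) (1, 1) := bellProj_eq_stabOp (1, 1)
  induction n with
  | zero => simpa [genSmolin] using hb
  | succ n ih =>
    rw [genSmolin, ih, hb]
    simp only [Matrix.mul_smul, Matrix.smul_mul,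
      onFirst_conj_stabOp (show 0 < 2 * (n + 1) by omega), onFirst_conj_stabOp two_pos,
      tensorPair_smul_smul, ← Finset.smul_sum]
    rw [sum_tensorPair_stabOp, smul_smul, smul_smul, Finset.sum_range_succ _ (n + 1)]
    congr 1
    rw [pow_succ _ (n + 1)]
    field_simp

theorem exists_xzState_eq_pauli_conj_genSmolin {n : ℕ} (hn : 1 ≤ n) :
    ∃ a b : Fin (2 * n) → Fin 2,
      xzState n = (piTensor fun i => pauli (a i) (b i)) * genSmolin n *
        (piTensor fun i => pauli (a i) (b i))ᴴ := by
  obtain ⟨m, rfl⟩ : ∃ m, n = m + 1 := ⟨n - 1, by omega⟩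
  set r : Fin 2 × Fin 2 := ∑ _i ∈ Finset.range (m + 1), (1, 1) with hr
  -- One Pauli matrix on the first qubit suffices: it shifts the label `r` of the Smolin state to `r
  -- + r = 0`.
  refine ⟨fun i => if (i : ℕ) = 0 then r.1 else 0, fun i => if (i : ℕ) = 0 then r.2 else 0, ?_⟩
  have h : (piTensor fun i : Fin (2 * (m + 1)) =>
      pauli (if (i : ℕ) = 0 then r.1 else 0) (if (i : ℕ) = 0 then r.2 else 0)) =
      onFirst (2 * (m + 1)) (pauli r.1 r.2) := by
    rw [onFirst]
    congr 1
    ext1 i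
    split_ifs <;> rfl
  have hrr : ∀ r : Fin 2 × Fin 2, r + (r.1, r.2) = 0 := by decide
  rw [h, genSmolin_eq, Matrix.mul_smul, Matrix.smul_mul, ← hr,
    onFirst_conj_stabOp (show 0 < 2 * (m + 1) by omega), hrr, xzState_eq hn]

/-! ### Partial transposition -/

section PartialTranspose

variable {P : Type} [DecidableEq P] {H L : P → Type}

/-- The basis label which agrees with `y` on the parties in `S` and with `x` elsewhere. -/
def mix (S : Finset P) (x y : ∀ p, H p) : ∀ p, H p := fun p => if p ∈ S then y p else x p

/-- The partial transpose with respect to the parties in `S`. -/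
def ptrans (S : Finset P) (ρ : MultiOp H) : MultiOp H :=
  Matrix.of fun x y => ρ (mix S x y) (mix S y x)

theorem mix_mix (S : Finset P) (x y : ∀ p, H p) : mix S (mix S x y) (mix S y x) = x := by
  funext p; simp only [mix]; split_ifs <;> rfl

/-- The exchange of the labels of the parties in `S`. -/
def mixEquiv (S : Finset P) (H : P → Type) : (∀ p, H p) × (∀ p, H p) ≃ (∀ p, H p) × (∀ p, H p) where
  toFun z := (mix S z.1 z.2, mix S z.2 z.1)
  invFun z := (mix S z.1 z.2, mix S z.2 z.1)
  left_inv _ := Prod.ext (mix_mix S _ _) (mix_mix S _ _)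
  right_inv _ := Prod.ext (mix_mix S _ _) (mix_mix S _ _)

theorem ptrans_sum {κ : Type*} (S : Finset P) (s : Finset κ) (ρ : κ → MultiOp H) :
    ptrans S (∑ k ∈ s, ρ k) = ∑ k ∈ s, ptrans S (ρ k) := by
  ext x y; simp [ptrans, Matrix.sum_apply]

theorem ptrans_smul (S : Finset P) (c : ℂ) (ρ : MultiOp H) :
    ptrans S (c • ρ) = c • ptrans S ρ := rfl

theorem ptrans_copies (S : Finset P) (k : ℕ) (ρ : MultiOp H) :
    ptrans S (copies k ρ) = copies k (ptrans S ρ) := by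
  have h : ∀ (x y : ∀ p, Fin k → H p) (c : Fin k), (fun p => mix S x y p c) =
      mix S (fun p => x p c) (fun p => y p c) := fun x y c => by
    funext p; simp only [mix]; split_ifs <;> rfl
  ext x y
  simp only [ptrans, copies, Matrix.of_apply, h]

variable [Fintype P]

/-- Regrouped by copies instead of by parties, the state is an ordinary tensor power. -/
theorem posSemidef_copies [∀ p, Fintype (H p)] (k : ℕ) {ρ : MultiOp H} (hρ : ρ.PosSemidef) :
    (copies k ρ).PosSemidef :=
  (posSemidef_piTensor (A := fun _ : Fin k => ρ) fun _ => hρ).submatrix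
    (fun (x : ∀ p, Fin k → H p) c p => x p c)

theorem ptrans_piTensor (S : Finset P) (A : ∀ p, Matrix (H p) (H p) ℂ) :
    ptrans S (piTensor A) = piTensor fun p => if p ∈ S then (A p)ᵀ else A p := by
  ext x y
  simp only [ptrans, Matrix.of_apply, piTensor_apply, mix]
  refine Finset.prod_congr rfl fun p _ => ?_
  split_ifs <;> rfl

omit [DecidableEq P] [Fintype P] in
theorem mul_mul_apply_eq_sum {l m n o : Type*} [Fintype m] [Fintype n] (A : Matrix l m ℂ)
    (B : Matrix m n ℂ) (C : Matrix n o ℂ) (x : l) (y : o) :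
    (A * B * C) x y = ∑ z : m × n, A x z.1 * B z.1 z.2 * C z.2 y := by
  simp only [Matrix.mul_apply, Finset.sum_mul]
  rw [Finset.sum_comm, Fintype.sum_prod_type]

/-- Exchanging row and column indices on `S` also exchanges `K p` with its entrywise conjugate
there, so the result is again a conjugation by a product operator. -/
theorem ptrans_conj [∀ p, Fintype (H p)] (S : Finset P) (K : ∀ p, Matrix (L p) (H p) ℂ)
    (ρ : MultiOp H) :
    ptrans S (piTensor K * ρ * (piTensor K)ᴴ) =
      (piTensor fun p => if p ∈ S then (K p).map star else K p) * ptrans S ρ *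
        (piTensor fun p => if p ∈ S then (K p).map star else K p)ᴴ := by
  ext x' y'
  -- Both sides are sums over pairs of inner indices, matched by exchanging the `S`-components of
  -- each pair.
  refine (mul_mul_apply_eq_sum _ _ _ _ _).trans
    (((mixEquiv S H).sum_comp _).symm.trans ((Finset.sum_congr rfl fun z _ => ?_).trans
      (mul_mul_apply_eq_sum _ _ _ _ _).symm))
  refine (mul_right_comm _ _ _).trans
    ((congrArg (· * ρ (mix S z.1 z.2) (mix S z.2 z.1)) ?_).trans (mul_right_comm _ _ _))
  simp only [mixEquiv, Equiv.coe_fn_mk]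
  simp only [Matrix.conjTranspose_apply, piTensor_apply, star_prod, ← Finset.prod_mul_distrib]
  refine Finset.prod_congr rfl fun p _ => ?_
  simp only [mix]
  split_ifs
  · simp [mul_comm]
  · rfl

/-- By induction on the rounds: each branch conjugates the partial transpose by a product operator,
and sums of positive matrices are positive. -/
theorem IsLOCC.posSemidef_ptrans {H' : P → Type} [∀ p, Fintype (H' p)]
    [∀ p, DecidableEq (H' p)] (S : Finset P) {H : P → Type} [∀ p, Fintype (H p)]
    [∀ p, DecidableEq (H p)] {Λ : MultiOp H → MultiOp H'} (hΛ : IsLOCC H Λ) :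
    ∀ ρ : MultiOp H, (ptrans S ρ).PosSemidef → (ptrans S (Λ ρ)).PosSemidef := by
  induction hΛ with
  | done => exact fun ρ h => h
  | round K complete next locc ih =>
    intro ρ h
    rw [ptrans_sum]
    refine Matrix.posSemidef_sum _ fun a _ => ih a _ ?_
    rw [ptrans_conj]
    exact h.mul_mul_conjTranspose_same _

/-- The Peres criterion: partial transposition of a product state transposes some local states,
which remain positive. -/
theorem IsFullySeparable.posSemidef_ptrans [∀ p, Fintype (H p)] {ρ : MultiOp H}
    (h : IsFullySeparable ρ) (S : Finset P) : (ptrans S ρ).PosSemidef := by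
  obtain ⟨m, w, σ, hw, -, hσ, rfl⟩ := h
  rw [ptrans_sum]
  refine Matrix.posSemidef_sum _ fun k _ => ?_
  rw [ptrans_smul, ptrans_piTensor]
  refine (posSemidef_piTensor fun p => ?_).smul (by exact_mod_cast (hw k).le)
  split_ifs
  · exact (hσ k p).1.transpose
  · exact (hσ k p).1

omit [DecidableEq P] [Fintype P] in
theorem posSemidef_of_forall_exists_norm_sub_lt {m : Type} [Fintype m] {M : Matrix m m ℂ}
    (h : ∀ ε : ℝ, 0 < ε → ∃ N : Matrix m m ℂ, N.PosSemidef ∧ ∀ x y, ‖N x y - M x y‖ < ε) :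
    M.PosSemidef := by
  choose N hN hNM using fun k : ℕ => h (1 / ((k : ℝ) + 1)) Nat.one_div_pos_of_nat
  have ht : ∀ x y, Filter.Tendsto (fun k => N k x y) Filter.atTop (nhds (M x y)) := fun x y =>
    tendsto_iff_norm_sub_tendsto_zero.2 (squeeze_zero (fun _ => norm_nonneg _)
      (fun k => (hNM k x y).le) tendsto_one_div_add_atTop_nhds_zero_nat)
  refine Matrix.PosSemidef.of_dotProduct_mulVec_nonneg ?_ fun v => ?_
  · ext x y
    have h1 : Filter.Tendsto (fun k => N k x y) Filter.atTop (nhds (star (M y x))) := by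
      have h2 : (fun k => star (N k y x)) = fun k => N k x y :=
        funext fun k => (hN k).1.apply x y
      exact h2 ▸ (ht y x).star
    exact tendsto_nhds_unique h1 (ht x y)
  · refine ge_of_tendsto' (f := fun k => star v ⬝ᵥ N k *ᵥ v) (x := Filter.atTop) ?_
      fun k => (hN k).dotProduct_mulVec_nonneg v
    simp only [dotProduct, Matrix.mulVec]
    exact tendsto_finsetSum _ fun x _ => (tendsto_finsetSum _ fun y _ =>
      (ht x y).mul_const _).const_mul _

omit [DecidableEq P] [Fintype P] in
/-- A bipartite pure state with a positive partial transpose has rank one. -/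
theorem mul_eq_mul_of_posSemidef_ptrans {A B : Type} [Fintype A] [Fintype B] [DecidableEq B]
    {C : A → B → ℂ}
    (h : (Matrix.of fun x y : A × B => C y.1 x.2 * star (C x.1 y.2)).PosSemidef)
    (a a' : A) (b b' : B) : C a b * C a' b' = C a b' * C a' b := by
  -- The minors of `C` in the columns `b`, `b'`. The test vector `v` is chosen so that contracting
  -- it with `C` gives these minors; since `S` is antisymmetric, the quadratic form at `v` is minus
  -- the sum of their squared moduli.
  set S : A → A → ℂ := fun a a' => C a b * C a' b' - C a b' * C a' b with hS
  let v : A × B → ℂ := fun x =>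
    star (C x.1 b * (if x.2 = b' then 1 else 0) - C x.1 b' * (if x.2 = b then 1 else 0))
  have h1 : ∀ a a', ∑ c, star (v (a, c)) * C a' c = S a a' := fun a a' => by
    simp [v, hS, sub_mul]
  have h2 : star v ⬝ᵥ (Matrix.of fun x y : A × B => C y.1 x.2 * star (C x.1 y.2)) *ᵥ v =
      -∑ a, ∑ a', star (S a a') * S a a' := by
    calc _ = ∑ a, ∑ a', (∑ c, star (v (a, c)) * C a' c) *
          star (∑ c, star (v (a', c)) * C a c) := by
            simp only [star_sum, Finset.sum_mul_sum]
            simp only [dotProduct, Matrix.mulVec, Fintype.sum_prod_type, star_mul',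
              star_star, Finset.mul_sum, Pi.star_apply, Matrix.of_apply]
            refine Finset.sum_congr rfl fun a _ => ?_
            rw [Finset.sum_comm]
            exact Finset.sum_congr rfl fun a' _ => Finset.sum_congr rfl fun c _ =>
              Finset.sum_congr rfl fun c' _ => by ring
      _ = _ := by
        simp only [h1, ← Finset.sum_neg_distrib]
        refine Finset.sum_congr rfl fun a _ => Finset.sum_congr rfl fun a' _ => ?_
        rw [show S a' a = -S a a' by simp only [hS]; ring, star_neg]; ring
  have h3 := h.dotProduct_mulVec_nonneg v
  rw [h2, neg_nonneg] at h3
  have h4 : ∀ a a', 0 ≤ star (S a a') * S a a' := fun a a' => star_mul_self_nonneg _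
  have h5 := (Finset.sum_eq_zero_iff_of_nonneg fun a _ => Finset.sum_nonneg fun a' _ => h4 a a').1
    (le_antisymm h3 (Finset.sum_nonneg fun a _ => Finset.sum_nonneg fun a' _ => h4 a a'))
    a (Finset.mem_univ a)
  have h6 := (Finset.sum_eq_zero_iff_of_nonneg fun a' _ => h4 a a').1 h5 a' (Finset.mem_univ a')
  exact sub_eq_zero.1 (by simpa using h6)

end PartialTranspose

/-! ### States with a positive partial transpose are not distillable -/

/-- The target state is a limit of outputs with positive partial transpose, hence has one itself. As
only `p` and `q` hold nontrivial systems, this is a bipartite transpose, and `ψ` must be a product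
vector. -/
theorem not_distillableBetween_of_posSemidef_ptrans {P : Type} [Fintype P] [DecidableEq P]
    {H : P → Type} [∀ p, Fintype (H p)] [∀ p, DecidableEq (H p)] {ρ : MultiOp H} {p q : P}
    {S : Finset P} (hp : p ∈ S) (hq : q ∉ S) (hρ : (ptrans S ρ).PosSemidef) :
    ¬ DistillableBetween ρ p q := by
  rintro ⟨H', _, _, ψ, hsub, hnorm, hent, h⟩
  have hpq : p ≠ q := fun e => hq (e ▸ hp)
  have hM : (ptrans S (Matrix.of fun x y => ψ x * star (ψ y) : MultiOp H')).PosSemidef := by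
    refine posSemidef_of_forall_exists_norm_sub_lt fun ε hε => ?_
    obtain ⟨k, Λ, hΛ, hclose⟩ := h ε hε
    refine ⟨ptrans S (Λ (copies k ρ)), hΛ.posSemidef_ptrans S _ ?_, fun x y => hclose _ _⟩
    rw [ptrans_copies]
    exact posSemidef_copies k hρ
  obtain ⟨x₀, hx₀⟩ : ∃ x, ψ x ≠ 0 := by
    by_contra! h0
    simp [h0] at hnorm
  let f : H' p × H' q → ∀ r, H' r := fun z =>
    Function.update (Function.update x₀ p z.1) q z.2
  have hfp : ∀ z, f z p = z.1 := fun z => by simp [f, hpq]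
  have hfq : ∀ z, f z q = z.2 := fun z => by simp [f]
  have hext : ∀ x y : ∀ r, H' r, x p = y p → x q = y q → x = y := by
    intro x y h1 h2
    funext r
    by_cases hr1 : r = p
    · exact hr1 ▸ h1
    by_cases hr2 : r = q
    · exact hr2 ▸ h2
    exact (hsub r hr1 hr2).elim _ _
  have hmix : ∀ z w, mix S (f z) (f w) = f (w.1, z.2) := fun z w =>
    hext _ _ (by simp [mix, hp, hfp]) (by simp [mix, hq, hfq])
  have hC := mul_eq_mul_of_posSemidef_ptrans (C := fun a b => ψ (f (a, b))) (by
    have := hM.submatrix f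
    convert this using 1
    ext z w
    simp only [ptrans, Matrix.submatrix_apply, Matrix.of_apply, hmix])
  -- A rank-one matrix is the product of its row and its column through a nonzero entry, divided by
  -- that entry. The parties other than `p` and `q` contribute the factor one.
  refine hent ⟨fun r u => ψ (Function.update x₀ r u) / ψ x₀ * (if r = p then ψ x₀ else 1),
    fun x => ?_⟩
  rw [Finset.prod_mul_distrib, Finset.prod_ite_eq' Finset.univ p fun _ => ψ x₀,
    if_pos (Finset.mem_univ p), Fintype.prod_eq_mul p q hpq]
  · have h1 : Function.update x₀ p (x p) = f (x p, x₀ q) :=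
      hext _ _ (by simp [hfp]) (by simp [hfq, hpq.symm])
    have h2 : Function.update x₀ q (x q) = f (x₀ p, x q) :=
      hext _ _ (by simp [hfp, hpq]) (by simp [hfq])
    have h3 : x = f (x p, x q) := hext _ _ (by simp [hfp]) (by simp [hfq])
    have h4 : x₀ = f (x₀ p, x₀ q) := hext _ _ (by simp [hfp]) (by simp [hfq])
    have h5 := hC (x p) (x₀ p) (x q) (x₀ q)
    simp only [← h3, ← h4, ← h1, ← h2] at h5
    field_simp
    rw [h5]
  · rintro r ⟨hr1, hr2⟩
    have : Function.update x₀ r (x r) = x₀ :=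
      hext _ _ (by simp [hr1.symm]) (by simp [hr2.symm])
    rw [this, div_self hx₀]

/-! ### Bound entanglement -/

section Bound

variable {ι : Type} [Fintype ι] [DecidableEq ι]

theorem ptrans_weylPow (S : Finset ι) (t : Fin 2 × Fin 2) :
    ptrans S (weylPow ι t) = ((-1 : ℂ) ^ ((t.1 : ℕ) * (t.2 : ℕ))) ^ S.card • weylPow ι t := by
  have h : ∀ i, (if i ∈ S then (weyl t)ᵀ else weyl t) =
      (if i ∈ S then (-1 : ℂ) ^ ((t.1 : ℕ) * (t.2 : ℕ)) else 1) • weyl t := fun i => by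
    rw [weyl_transpose]; split_ifs <;> simp
  rw [weylPow, ptrans_piTensor]
  simp only [h, piTensor_smul, Finset.prod_ite_mem, Finset.univ_inter, Finset.prod_const]

theorem ptrans_stabOp_of_even {S : Finset ι} (hS : Even S.card) (r : Fin 2 × Fin 2) :
    ptrans S (stabOp ι r) = stabOp ι r := by
  rw [stabOp, ptrans_sum]
  refine Finset.sum_congr rfl fun t _ => ?_
  rw [ptrans_smul, ptrans_weylPow, ← pow_mul, mul_comm, pow_mul, hS.neg_one_pow, one_pow,
    one_smul]

theorem not_posSemidef_ptrans_stabOp [Nonempty ι] (h : Even (Fintype.card ι)) (i : ι)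
    (r : Fin 2 × Fin 2) : ¬ (ptrans {i} (stabOp ι r)).PosSemidef := by
  intro hpos
  -- On this sector the partial transpose has the eigenvalue `1 - 1 - 1 - 1 = -2`; the last sign is
  -- the one changed by transposing `weyl (1, 1)`.
  set B := stabOp ι (r + (1, 1)) with hB
  have h1 : ptrans {i} (stabOp ι r) * B = (-2 : ℂ) • B := by
    rw [stabOp, ptrans_sum, Finset.sum_mul]
    simp only [ptrans_smul, ptrans_weylPow, Finset.card_singleton, pow_one, Matrix.smul_mul, hB,
      weylPow_mul_stabOp h, smul_smul, ← Finset.sum_smul]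
    congr 1
    have h2 : ∀ t, sympSign r t * ((-1) ^ ((t.1 : ℕ) * (t.2 : ℕ)) * sympSign (r + (1, 1)) t) =
        (-1) ^ ((t.1 : ℕ) * (t.2 : ℕ)) * sympSign (1, 1) t := fun t => by
      rw [sympSign_add]
      linear_combination ((-1) ^ ((t.1 : ℕ) * (t.2 : ℕ)) * sympSign (1, 1) t) *
        sympSign_mul_self r t
    simp only [← mul_assoc] at h2 ⊢
    simp only [h2, sum_bits]
    simp [sympSign]
    norm_num
  have h3 := (hpos.mul_mul_conjTranspose_same B).trace_nonneg
  rw [mul_assoc, hB, stabOp_conjTranspose h, ← hB, h1, Matrix.mul_smul, stabOp_mul_stabOp h,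
    if_pos rfl, smul_smul, Matrix.trace_smul, trace_stabOp, smul_eq_mul,
    show (-2 : ℂ) * 4 * 2 ^ Fintype.card ι = -((8 * 2 ^ Fintype.card ι : ℝ) : ℂ) by
      push_cast; ring, neg_nonneg, ← Complex.ofReal_zero, Complex.real_le_real] at h3
  exact absurd h3 (not_le.2 (by positivity))

end Bound

theorem isBoundEntangled_stabOp {n : ℕ} (hn : 2 ≤ n) (r : Fin 2 × Fin 2) :
    IsBoundEntangled ((1 / 4 ^ n : ℂ) • stabOp (Fin (2 * n)) r) := by
  have he := even_card_fin_two_mul n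
  have : Nonempty (Fin (2 * n)) := ⟨⟨0, by omega⟩⟩
  have hc : (0 : ℂ) ≤ 1 / 4 ^ n := by positivity
  refine ⟨⟨(posSemidef_stabOp he r).smul hc, ?_⟩, fun hs => ?_, fun i j hij => ?_⟩
  · rw [Matrix.trace_smul, trace_stabOp, Fintype.card_fin, pow_mul, smul_eq_mul]
    norm_num
  · have h1 := hs.posSemidef_ptrans {this.some}
    rw [ptrans_smul] at h1
    refine not_posSemidef_ptrans_stabOp he this.some r ?_
    have h2 := h1.smul (show (0 : ℂ) ≤ 4 ^ n by positivity)
    rwa [smul_smul, mul_one_div_cancel (by positivity), one_smul] at h2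
  -- A third qubit `k` makes the cut `{i, k}` even while still separating `i` from `j`; this is
  -- where `n ≥ 2` enters.
  · obtain ⟨k, hk⟩ : ∃ k, k ∉ ({i, j} : Finset (Fin (2 * n))) := by
      by_contra! hall
      have h1 := Finset.card_le_card (fun k _ => hall k : Finset.univ ⊆ {i, j})
      have h2 : ({i, j} : Finset (Fin (2 * n))).card ≤ 2 := Finset.card_le_two
      rw [Finset.card_univ, Fintype.card_fin] at h1
      omega
    simp only [Finset.mem_insert, Finset.mem_singleton, not_or] at hk
    refine not_distillableBetween_of_posSemidef_ptrans (S := {i, k}) (by simp)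
      (by simp [hij.symm, Ne.symm hk.2]) ?_
    rw [ptrans_smul, ptrans_stabOp_of_even (by rw [Finset.card_pair (Ne.symm hk.1)]; decide)]
    exact (posSemidef_stabOp he r).smul hc

/-! ### Blocks of a partition of the qubits -/

section Blocks

variable {ι : Type} [Fintype ι] [DecidableEq ι] (π : Finpartition (Finset.univ : Finset ι))

/-- A qubit together with its block is just a qubit. -/
def blockEquiv : (Σ T : {T // T ∈ π.parts}, {i // i ∈ T.1}) ≃ ι :=
  π.equivSigmaParts.symm.trans (Equiv.subtypeUnivEquiv Finset.mem_univ)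

theorem prod_blocks (f : ι → ℂ) :
    ∏ i, f i = ∏ T : {T // T ∈ π.parts}, ∏ l : {i // i ∈ T.1}, f l := by
  rw [← (blockEquiv π).prod_comp, Fintype.prod_sigma]
  rfl

theorem glue_apply (x : ∀ T : {T // T ∈ π.parts}, ({i // i ∈ T.1} → Fin 2))
    (T : {T // T ∈ π.parts}) (l : {i // i ∈ T.1}) : glue π x l = x T l := by
  obtain ⟨T, hT⟩ := T
  obtain ⟨l, hl⟩ := l
  have h : π.part l = T := π.part_eq_of_mem hT hl
  subst h
  rfl

theorem groupState_weylPow (t : Fin 2 × Fin 2) :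
    groupState π (weylPow ι t) = piTensor fun T : {T // T ∈ π.parts} => weylPow {i // i ∈ T.1} t := by
  ext x y
  rw [groupState, Matrix.submatrix_apply, weylPow, piTensor_apply, prod_blocks π, piTensor_apply]
  simp only [glue_apply]
  rfl

theorem groupState_stabOp (r : Fin 2 × Fin 2) :
    groupState π (stabOp ι r) =
      ∑ t, sympSign r t • piTensor fun T : {T // T ∈ π.parts} => weylPow {i // i ∈ T.1} t := by
  simp only [← groupState_weylPow]
  ext x y
  simp [groupState, stabOp, Matrix.sum_apply]

/-- The pairing of the qubits by a partition into blocks of size two. -/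
def pairEquiv (hπ : ∀ T ∈ π.parts, T.card = 2) : {T // T ∈ π.parts} × Fin 2 ≃ ι :=
  (Equiv.sigmaEquivProd _ _).symm.trans
    ((Equiv.sigmaCongrRight fun T => (Finset.equivFinOfCardEq (hπ T.1 T.2)).symm).trans
      (blockEquiv π))

end Blocks

/-! ### Separability with respect to partitions into pairs -/

theorem isFullySeparable_of_fintype {P : Type} [Fintype P] {H : P → Type} [∀ p, Fintype (H p)]
    {κ : Type} [Fintype κ] (w : κ → ℝ) (σ : κ → ∀ p, Matrix (H p) (H p) ℂ) (hw : ∀ k, 0 < w k)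
    (hw1 : ∑ k, w k = 1) (hσ : ∀ k p, IsDensity (σ k p)) :
    IsFullySeparable (∑ k, (w k : ℂ) • piTensor (σ k)) :=
  ⟨Fintype.card κ, w ∘ (Fintype.equivFin κ).symm, σ ∘ (Fintype.equivFin κ).symm,
    fun _ => hw _, by rw [← hw1]; exact (Fintype.equivFin κ).symm.sum_comp w, fun _ => hσ _,
    ((Fintype.equivFin κ).symm.sum_comp fun k => (w k : ℂ) • piTensor (σ k)).symm⟩

theorem isDensity_bellProj (a b : Fin 2) : IsDensity (bellProj a b) := by
  refine ⟨?_, ?_⟩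
  · have := Matrix.posSemidef_vecMulVec_self_star (bell a b)
    exact this
  · have := sum_star_bell_mul_bell (a, b) (a, b)
    simpa [Matrix.trace, bellProj, mul_comm] using this

theorem IsDensity.submatrix_equiv {m n : Type} [Fintype m] [Fintype n] {ρ : Matrix m m ℂ}
    (hρ : IsDensity ρ) (e : n ≃ m) : IsDensity (ρ.submatrix e e) :=
  ⟨hρ.1.submatrix e, (e.sum_comp fun i => ρ i i).trans hρ.2⟩

/-- Only the trivial character contributes to the count, so a quarter of all labellings satisfy both
parity constraints. This normalizes the separable decomposition. -/
theorem sum_sum_eq_zero_indicator_eq {K : Type} [Fintype K] [DecidableEq K] [Nonempty K] :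
    ∑ z : (K → Fin 2) × (K → Fin 2), (if ∑ i, z.1 i = 0 ∧ ∑ i, z.2 i = 0 then (1 : ℂ) else 0) =
      4 ^ Fintype.card K / 4 := by
  simp only [sum_sum_eq_zero_indicator, ← Finset.mul_sum]
  rw [Fintype.sum_prod_type]
  have h : ∀ t, ∑ α : K → Fin 2, ∑ β : K → Fin 2, ∏ i, sympSign (α i, β i) t =
      if t = 0 then 4 ^ Fintype.card K else 0 := by
    intro t
    have h1 : ∑ a : Fin 2, ∑ b : Fin 2, sympSign (a, b) t = if t = 0 then 4 else 0 := by
      rw [← Fintype.sum_prod_type (f := fun a => sympSign a t)]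
      exact (Finset.sum_congr rfl fun a _ => sympSign_comm a t).trans (sum_sympSign t)
    have h3 : ∑ α : K → Fin 2, ∑ β : K → Fin 2, ∏ i, sympSign (α i, β i) t =
        ∏ _i : K, ∑ a : Fin 2, ∑ b : Fin 2, sympSign (a, b) t := by
      simp only [Fintype.prod_sum]
    rw [h3, h1, Finset.prod_const, Finset.card_univ]
    split_ifs
    · rfl
    · exact zero_pow Fintype.card_ne_zero
  have h2 : ∑ α : K → Fin 2, ∑ β : K → Fin 2, ∑ t, ∏ i, sympSign (α i, β i) t =
      ∑ t, ∑ α : K → Fin 2, ∑ β : K → Fin 2, ∏ i, sympSign (α i, β i) t := by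
    exact (Finset.sum_congr rfl fun α _ => Finset.sum_comm).trans Finset.sum_comm
  rw [h2]
  simp only [h, Finset.sum_ite_eq', Finset.mem_univ, if_true]
  ring

/-- In the Bell decomposition adapted to the partition, each Bell projector is a local state of one
block. -/
theorem separableWrt_xzState {n : ℕ} (hn : 1 ≤ n)
    (π : Finpartition (Finset.univ : Finset (Fin (2 * n)))) (hπ : ∀ T ∈ π.parts, T.card = 2) :
    SeparableWrt π (xzState n) := by
  set K := {T // T ∈ π.parts}
  have hcard : Fintype.card K = n := by
    have := Fintype.card_congr (pairEquiv π hπ)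
    rw [Fintype.card_prod, Fintype.card_fin, Fintype.card_fin] at this
    change Fintype.card K * 2 = _ at this
    omega
  have : Nonempty K := Fintype.card_pos_iff.1 (by omega)
  let eT : ∀ T : K, ({i // i ∈ T.1} → Fin 2) ≃ (Fin 2 → Fin 2) := fun T =>
    Equiv.arrowCongr (Finset.equivFinOfCardEq (hπ T.1 T.2)) (Equiv.refl _)
  let κ := {z : (K → Fin 2) × (K → Fin 2) // ∑ i, z.1 i = 0 ∧ ∑ i, z.2 i = 0}
  have hs := isFullySeparable_of_fintype (κ := κ) (fun _ => 4 / 4 ^ n)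
    (fun z T => (bellProj (z.1.1 T) (z.1.2 T)).submatrix (eT T) (eT T))
    (fun _ => by positivity) ?_ (fun z T => (isDensity_bellProj _ _).submatrix_equiv _)
  · rw [SeparableWrt]
    convert hs using 1
    ext x y
    rw [groupState, Matrix.submatrix_apply, xzState_eq hn, Matrix.smul_apply,
      stabOp_eq_sum_bellProj (pairEquiv π hπ), ← Finset.smul_sum, Matrix.smul_apply,
      Matrix.sum_apply, smul_eq_mul, smul_eq_mul, ← mul_assoc]
    congr 1
    · push_cast; ring
    · rw [← Fintype.sum_prod_type (f := fun z : (K → Fin 2) × (K → Fin 2) =>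
        if ∑ i, z.1 i = 0 ∧ ∑ i, z.2 i = 0 then
          ∏ i, bellProj (z.1 i) (z.2 i) (fun j => glue π x (pairEquiv π hπ (i, j)))
            (fun j => glue π y (pairEquiv π hπ (i, j))) else 0), ← Finset.sum_filter,
        Finset.sum_subtype _ (p := fun z : (K → Fin 2) × (K → Fin 2) =>
          ∑ i, z.1 i = 0 ∧ ∑ i, z.2 i = 0) (by simp)]
      refine Finset.sum_congr rfl fun z _ => Finset.prod_congr rfl fun T _ => ?_
      have hx : ∀ x : ∀ T : K, ({i // i ∈ T.1} → Fin 2),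
          (fun j => glue π x (pairEquiv π hπ (T, j))) = eT T (x T) := fun x =>
        funext fun j => glue_apply π x T _
      rw [hx, hx]
      rfl
  · have h := sum_sum_eq_zero_indicator_eq (K := K)
    rw [hcard, Finset.sum_boole, ← Fintype.card_subtype] at h
    have h2 : ((∑ _z : κ, (4 / 4 ^ n : ℝ) : ℝ) : ℂ) = 1 := by
      rw [Finset.sum_const, Finset.card_univ, nsmul_eq_mul]
      push_cast
      rw [h]
      field_simp
    exact_mod_cast h2

/-! ### Distillation by local measurements and a correction -/

section Protocol

variable {P : Type} [Fintype P] [DecidableEq P] {H H' : P → Type}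
  [∀ p, Fintype (H p)] [∀ p, Fintype (H' p)]

/-- The output of the protocol when the measurement operators turn the local factors `A t p` into
multiples of `D t p` by signs, which the corrections compensate. -/
theorem sum_measure_correct (K : ∀ p, Fin 2 × Fin 2 → Matrix (H' p) (H p) ℂ)
    (A : Fin 2 × Fin 2 → ∀ p, Matrix (H p) (H p) ℂ)
    (D : Fin 2 × Fin 2 → ∀ p, Matrix (H' p) (H' p) ℂ) (w : P → ℂ)
    (hK : ∀ p a t, K p a * A t p * (K p a)ᴴ = (w p * sympSign a t) • D t p)
    (s : Fin 2 × Fin 2) (U : Fin 2 × Fin 2 → ∀ p, Matrix (H' p) (H' p) ℂ)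
    (hU : ∀ r t, (piTensor fun p => U r p * D t p * (U r p)ᴴ) = sympSign r t • piTensor (D t)) :
    ∑ a : P → Fin 2 × Fin 2, piTensor (U (s + ∑ p, a p)) *
        (piTensor (fun p => K p (a p)) * (∑ t, sympSign s t • piTensor (A t)) *
          (piTensor fun p => K p (a p))ᴴ) * (piTensor (U (s + ∑ p, a p)))ᴴ =
      (∏ p, 4 * w p) • ∑ t, piTensor (D t) := by
  have h : ∀ (a : P → Fin 2 × Fin 2), piTensor (U (s + ∑ p, a p)) *
        (piTensor (fun p => K p (a p)) * (∑ t, sympSign s t • piTensor (A t)) *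
          (piTensor fun p => K p (a p))ᴴ) * (piTensor (U (s + ∑ p, a p)))ᴴ =
      (∏ p, w p) • ∑ t, piTensor (D t) := by
    intro a
    simp only [Matrix.mul_sum, Matrix.sum_mul, Matrix.mul_smul, Matrix.smul_mul, piTensor_conj, hK,
      piTensor_smul, hU, Finset.smul_sum, smul_smul, Finset.prod_mul_distrib]
    refine Finset.sum_congr rfl fun t _ => ?_
    congr 1
    rw [← sympSign_sum, sympSign_add]
    -- The signs of `s` and of the total outcome each occur twice, once in the measured state and
    -- once from the correction.
    linear_combination (∏ p, w p) * sympSign s t * sympSign s t *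
      sympSign_mul_self (∑ p, a p) t + (∏ p, w p) * sympSign_mul_self s t
  simp only [h]
  rw [Finset.sum_const, Finset.card_univ, Fintype.card_fun, Finset.prod_mul_distrib,
    Finset.prod_const, Finset.card_univ, mul_smul, ← Nat.cast_smul_eq_nsmul ℂ]
  simp

variable [∀ p, DecidableEq (H p)] [∀ p, DecidableEq (H' p)]

theorem isLOCC_unitary (U : ∀ p, Matrix (H' p) (H' p) ℂ) (hU : ∀ p, (U p)ᴴ * U p = 1) :
    IsLOCC (H' := H') H' (fun ρ => piTensor U * ρ * (piTensor U)ᴴ) := by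
  have h := IsLOCC.round (H' := H') (H := H') (L := H') (O := fun _ => Unit) (fun p _ => U p)
    (fun p => by simpa using hU p) (fun _ ρ => ρ) (fun _ => IsLOCC.done)
  convert h using 2 with ρ
  simp

/-- A local measurement on a single copy, followed by unitary corrections which depend on the
outcomes. -/
theorem exists_isLOCC_measure_correct {O : P → Type} [∀ p, Fintype (O p)]
    (K : ∀ p, O p → Matrix (H' p) (H p) ℂ) (hK : ∀ p, ∑ a, (K p a)ᴴ * K p a = 1)
    (U : (∀ p, O p) → ∀ p, Matrix (H' p) (H' p) ℂ) (hU : ∀ a p, (U a p)ᴴ * U a p = 1) :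
    ∃ Λ : MultiOp (fun p => Fin 1 → H p) → MultiOp H', IsLOCC (fun p => Fin 1 → H p) Λ ∧
      ∀ ρ : MultiOp H, Λ (copies 1 ρ) = ∑ a : ∀ p, O p,
        piTensor (U a) * (piTensor (fun p => K p (a p)) * ρ * (piTensor fun p => K p (a p))ᴴ) *
          (piTensor (U a))ᴴ := by
  let F : (∀ p, Fin 1 → H p) ≃ ∀ p, H p := Equiv.piCongrRight fun p => Equiv.funUnique (Fin 1) (H p)
  let K' : ∀ p, O p → Matrix (H' p) (Fin 1 → H p) ℂ := fun p a =>
    (K p a).submatrix id (Equiv.funUnique (Fin 1) (H p))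
  refine ⟨_, IsLOCC.round K' (fun p => ?_) (fun a ρ => piTensor (U a) * ρ * (piTensor (U a))ᴴ)
    (fun a => isLOCC_unitary (U a) (hU a)), fun ρ => Finset.sum_congr rfl fun a _ => ?_⟩
  · have h : ∀ a, (K' p a)ᴴ * K' p a = ((K p a)ᴴ * K p a).submatrix
        (Equiv.funUnique (Fin 1) (H p)) (Equiv.funUnique (Fin 1) (H p)) := fun a => rfl
    simp only [h]
    rw [← Matrix.submatrix_one_equiv (Equiv.funUnique (Fin 1) (H p)), ← hK p]
    ext x y
    simp [Matrix.sum_apply]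
  · have h1 : piTensor (fun p => K' p (a p)) = (piTensor fun p => K p (a p)).submatrix id F := rfl
    have h2 : copies 1 ρ = ρ.submatrix F F := by
      ext x y; simp [copies, F]; rfl
    rw [h1, h2, Matrix.conjTranspose_submatrix, Matrix.submatrix_mul_equiv,
      Matrix.submatrix_mul_equiv, Matrix.submatrix_id_id]

end Protocol

/-! ### Local measurements -/

section Local

variable {κ : Type} [Fintype κ] [DecidableEq κ] (Q : κ → Prop) [DecidablePred Q]

/-- No qubit satisfies `Q`, so the output space is one-dimensional and the Kraus operators are the
four Bell bras. -/
theorem exists_bell_measurement (hκ : Fintype.card κ = 2) (hQ : ∀ l, ¬ Q l) :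
    ∃ K : Fin 2 × Fin 2 → Matrix ({l // Q l} → Fin 2) (κ → Fin 2) ℂ,
      ∑ a, (K a)ᴴ * K a = 1 ∧ ∀ a t, K a * weylPow κ t * (K a)ᴴ =
        sympSign a t • weylPow {l // Q l} t := by
  have : IsEmpty {l // Q l} := ⟨fun l => hQ l.1 l.2⟩
  let e : κ ≃ Fin 2 := Fintype.equivFinOfCardEq hκ
  let E : (κ → Fin 2) ≃ (Fin 2 → Fin 2) := Equiv.arrowCongr e (Equiv.refl _)
  refine ⟨fun a => Matrix.of fun _ x => star (bell a.1 a.2 (E x)), ?_, fun a t => ?_⟩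
  · ext x y
    have h := sum_bell_mul_star_bell (E x) (E y)
    rw [Matrix.one_apply]
    simp only [E.apply_eq_iff_eq] at h
    rw [← h, Matrix.sum_apply]
    refine Finset.sum_congr rfl fun a _ => ?_
    simp [Matrix.mul_apply]
  · ext x y
    have hW : ∀ u v, weylPow κ t u v = weyl t (E u 0) (E v 0) * weyl t (E u 1) (E v 1) :=
      fun u v => by
        rw [weylPow, piTensor_apply, ← e.symm.prod_comp, Fin.prod_univ_two]; rfl
    have h1 : weylPow {l // Q l} t x y = 1 := by rw [weylPow, piTensor_apply]; simp
    rw [Matrix.smul_apply, h1, smul_eq_mul, mul_one, ← bell_expectation, mul_mul_apply_eq_sum,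
      Fintype.sum_prod_type, ← E.sum_comp]
    refine Finset.sum_congr rfl fun u _ => ?_
    rw [← E.sum_comp]
    refine Finset.sum_congr rfl fun v _ => ?_
    simp [hW]

/-- A uniformly random Weyl operator with announced outcome. It keeps the qubit, yet has the outcome
set and sign rule of a Bell measurement, so one protocol treats all blocks alike. -/
theorem exists_weyl_twirl (hκ : Fintype.card κ = 1) (hQ : ∀ l, Q l) :
    ∃ K : Fin 2 × Fin 2 → Matrix ({l // Q l} → Fin 2) (κ → Fin 2) ℂ,
      ∑ a, (K a)ᴴ * K a = 1 ∧ ∀ a t, K a * weylPow κ t * (K a)ᴴ =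
        (1 / 4 * sympSign a t) • weylPow {l // Q l} t := by
  let E : ({l // Q l} → Fin 2) ≃ (κ → Fin 2) :=
    Equiv.arrowCongr (Equiv.subtypeUnivEquiv hQ) (Equiv.refl _)
  have hW : ∀ t, weylPow {l // Q l} t = (weylPow κ t).submatrix E E := fun t => by
    ext x y
    rw [Matrix.submatrix_apply, weylPow, weylPow, piTensor_apply, piTensor_apply,
      ← (Equiv.subtypeUnivEquiv hQ).symm.prod_comp]
    rfl
  refine ⟨fun a => (1 / 2 : ℂ) • (weylPow κ a).submatrix E id, ?_, fun a t => ?_⟩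
  · have h : ∀ a, ((1 / 2 : ℂ) • (weylPow κ a).submatrix E id)ᴴ *
        ((1 / 2 : ℂ) • (weylPow κ a).submatrix E id) = (1 / 4 : ℂ) • 1 := fun a => by
      rw [Matrix.conjTranspose_smul, Matrix.conjTranspose_submatrix, Matrix.smul_mul,
        Matrix.mul_smul, Matrix.submatrix_mul_equiv, smul_smul, weylPow, piTensor_conjTranspose,
        piTensor_mul]
      simp only [conjTranspose_mul_weyl]
      rw [piTensor_one, Matrix.submatrix_id_id]
      norm_num
    simp only [h, Finset.sum_const, Finset.card_univ, Fintype.card_prod, Fintype.card_fin]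
    rw [← Nat.cast_smul_eq_nsmul ℂ, smul_smul]
    norm_num
  · have h : weylPow κ a * weylPow κ t * (weylPow κ a)ᴴ = sympSign a t • weylPow κ t := by
      simp only [weylPow, piTensor_conj, weyl_conj, piTensor_smul, Finset.prod_const,
        Finset.card_univ, hκ, pow_one]
    have h2 : (weylPow κ a).submatrix E id * weylPow κ t * ((weylPow κ a)ᴴ).submatrix id E =
        (weylPow κ a * weylPow κ t * (weylPow κ a)ᴴ).submatrix E E := rfl
    rw [Matrix.conjTranspose_smul, Matrix.conjTranspose_submatrix, Matrix.smul_mul,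
      Matrix.smul_mul, Matrix.mul_smul, h2, h, hW, smul_smul, Matrix.submatrix_smul,
      Pi.smul_apply, Pi.smul_apply, smul_smul]
    norm_num

end Local

/-! ### Unlocking -/

section Unlock

variable {m : ℕ} {π : Finpartition (Finset.univ : Finset (Fin m))} {i j : Fin m}

theorem PairsAllBut.prod_eq (h : PairsAllBut π i j) (hij : i ≠ j)
    (g : ∀ T : {T // T ∈ π.parts}, {l : {l // l ∈ T.1} // l.1 = i ∨ l.1 = j} → ℂ) :
    ∏ T, ∏ l, g T l = g ⟨{i}, h.1⟩ ⟨⟨i, Finset.mem_singleton_self i⟩, Or.inl rfl⟩ *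
      g ⟨{j}, h.2.1⟩ ⟨⟨j, Finset.mem_singleton_self j⟩, Or.inr rfl⟩ := by
  rw [Fintype.prod_eq_mul (⟨{i}, h.1⟩ : {T // T ∈ π.parts}) ⟨{j}, h.2.1⟩
    (by simpa [Subtype.ext_iff] using hij)]
  · congr 1
    · refine Fintype.prod_eq_single _ fun l hl => absurd ?_ hl
      exact Subtype.ext (Subtype.ext (Finset.mem_singleton.1 l.1.2))
    · refine Fintype.prod_eq_single _ fun l hl => absurd ?_ hl
      exact Subtype.ext (Subtype.ext (Finset.mem_singleton.1 l.1.2))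
  · rintro T ⟨h1, h2⟩
    refine Finset.prod_eq_one fun l _ => ?_
    obtain ⟨⟨l, hl⟩, rfl | rfl⟩ := l
    · exact absurd (Subtype.ext (π.eq_of_mem_parts T.2 h.1 hl (Finset.mem_singleton_self _))) h1
    · exact absurd (Subtype.ext (π.eq_of_mem_parts T.2 h.2.1 hl (Finset.mem_singleton_self _))) h2

theorem PairsAllBut.card_eq_one_or_two (h : PairsAllBut π i j) (T : {T // T ∈ π.parts}) :
    (Fintype.card {l // l ∈ T.1} = 1 ∧ ∀ l : {l // l ∈ T.1}, l.1 = i ∨ l.1 = j) ∨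
      (Fintype.card {l // l ∈ T.1} = 2 ∧ ∀ l : {l // l ∈ T.1}, ¬ (l.1 = i ∨ l.1 = j)) := by
  obtain ⟨T, hT⟩ := T
  simp only [Fintype.card_coe]
  by_cases h1 : T = {i}
  · subst h1
    exact Or.inl ⟨Finset.card_singleton i, fun l => Or.inl (Finset.mem_singleton.1 l.2)⟩
  by_cases h2 : T = {j}
  · subst h2
    exact Or.inl ⟨Finset.card_singleton j, fun l => Or.inr (Finset.mem_singleton.1 l.2)⟩
  refine Or.inr ⟨h.2.2 T hT h1 h2, ?_⟩
  rintro ⟨l, hl⟩ (rfl | rfl)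
  · exact h1 (π.eq_of_mem_parts hT h.1 hl (Finset.mem_singleton_self _))
  · exact h2 (π.eq_of_mem_parts hT h.2.1 hl (Finset.mem_singleton_self _))

/-- Every block has a measurement which turns powers of Weyl operators into powers of Weyl
operators on the qubits `i` and `j`, up to the sign given by the outcome. -/
theorem PairsAllBut.exists_measurement (h : PairsAllBut π i j) (T : {T // T ∈ π.parts}) :
    ∃ K : Fin 2 × Fin 2 → Matrix ({l : {l // l ∈ T.1} // l.1 = i ∨ l.1 = j} → Fin 2)
        ({l // l ∈ T.1} → Fin 2) ℂ,
      ∑ a, (K a)ᴴ * K a = 1 ∧ ∀ a t, K a * weylPow {l // l ∈ T.1} t * (K a)ᴴ =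
        ((1 / 4 * ∏ l : {l // l ∈ T.1}, if l.1 = i ∨ l.1 = j then 1 else 2) * sympSign a t) •
          weylPow {l : {l // l ∈ T.1} // l.1 = i ∨ l.1 = j} t := by
  rcases h.card_eq_one_or_two T with ⟨h1, h2⟩ | ⟨h1, h2⟩
  · obtain ⟨K, hK1, hK2⟩ := exists_weyl_twirl (fun l : {l // l ∈ T.1} => l.1 = i ∨ l.1 = j) h1 h2
    refine ⟨K, hK1, fun a t => ?_⟩
    rw [hK2, Finset.prod_congr rfl fun l _ => if_pos (h2 l)]
    simp
  · obtain ⟨K, hK1, hK2⟩ :=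
      exists_bell_measurement (fun l : {l // l ∈ T.1} => l.1 = i ∨ l.1 = j) h1 h2
    refine ⟨K, hK1, fun a t => ?_⟩
    rw [hK2, Finset.prod_congr rfl fun l _ => if_neg (h2 l), Finset.prod_const, Finset.card_univ,
      h1]
    norm_num

/-- The block weights of `PairsAllBut.exists_measurement` are written as products over qubits so
that they combine to this product over the register, which turns the normalization `1 / 2 ^ m` into
`1 / 4`. -/
theorem prod_ite_one_two (hij : i ≠ j) :
    (∏ l : Fin m, if l = i ∨ l = j then (1 : ℂ) else 2) * 4 = 2 ^ m := by
  have h : ∀ l : Fin m, (if l = i ∨ l = j then (1 : ℂ) else 2) *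
      ((if l = i then 2 else 1) * (if l = j then 2 else 1)) = 2 := by
    intro l
    by_cases h1 : l = i
    · subst h1; simp [hij]
    · by_cases h2 : l = j <;> simp [h1, h2, hij.symm]
  have h2 := Finset.prod_congr (rfl : (Finset.univ : Finset (Fin m)) = _) fun l _ => h l
  rw [Finset.prod_mul_distrib, Finset.prod_mul_distrib] at h2
  simp only [Finset.prod_ite_eq', Finset.mem_univ, if_true, Finset.prod_const, Finset.card_univ,
    Fintype.card_fin] at h2
  rw [← h2]
  norm_num

theorem PairsAllBut.distillableBetween (h : PairsAllBut π i j) (hij : i ≠ j)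
    (s : Fin 2 × Fin 2) :
    DistillableBetween (groupState π ((1 / 2 ^ m : ℂ) • stabOp (Fin m) s))
      ⟨{i}, h.1⟩ ⟨{j}, h.2.1⟩ := by
  let A : {T // T ∈ π.parts} := ⟨{i}, h.1⟩
  let B : {T // T ∈ π.parts} := ⟨{j}, h.2.1⟩
  let li : {l : {l // l ∈ A.1} // l.1 = i ∨ l.1 = j} :=
    ⟨⟨i, Finset.mem_singleton_self i⟩, Or.inl rfl⟩
  let lj : {l : {l // l ∈ B.1} // l.1 = i ∨ l.1 = j} :=
    ⟨⟨j, Finset.mem_singleton_self j⟩, Or.inr rfl⟩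
  have hprod : ∀ g : ∀ T : {T // T ∈ π.parts}, {l : {l // l ∈ T.1} // l.1 = i ∨ l.1 = j} → ℂ,
      ∏ T, ∏ l, g T l = g A li * g B lj := h.prod_eq hij
  let D : Fin 2 × Fin 2 → ∀ T : {T // T ∈ π.parts},
      Matrix ({l : {l // l ∈ T.1} // l.1 = i ∨ l.1 = j} → Fin 2)
        ({l : {l // l ∈ T.1} // l.1 = i ∨ l.1 = j} → Fin 2) ℂ := fun t T => weylPow _ t
  let ψ : (∀ T : {T // T ∈ π.parts}, {l : {l // l ∈ T.1} // l.1 = i ∨ l.1 = j} → Fin 2) → ℂ :=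
    fun x => bell 0 0 ![x A li, x B lj]
  have hψ : ∀ x y, ψ x * star (ψ y) = 1 / 4 * ∑ t, piTensor (D t) x y := by
    intro x y
    have h1 := bellProj_eq (0, 0) ![x A li, x B lj] ![y A li, y B lj]
    rw [show ψ x * star (ψ y) = bellProj 0 0 ![x A li, x B lj] ![y A li, y B lj] from rfl, h1]
    congr 1
    refine Finset.sum_congr rfl fun t _ => ?_
    rw [show ((0, 0) : Fin 2 × Fin 2) = 0 from rfl, sympSign_zero, one_mul]
    exact (hprod fun T l => weyl t (x T l) (y T l)).symm
  refine ⟨fun T => {l : {l // l ∈ T.1} // l.1 = i ∨ l.1 = j} → Fin 2, inferInstance,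
    inferInstance, ψ, ?_, ?_, ?_, ?_⟩
  · intro T hTA hTB
    have : IsEmpty {l : {l // l ∈ T.1} // l.1 = i ∨ l.1 = j} := by
      refine ⟨fun l => ?_⟩
      obtain ⟨⟨l, hl⟩, rfl | rfl⟩ := l
      · exact hTA (Subtype.ext (π.eq_of_mem_parts T.2 h.1 hl (Finset.mem_singleton_self _)))
      · exact hTB (Subtype.ext (π.eq_of_mem_parts T.2 h.2.1 hl (Finset.mem_singleton_self _)))
    infer_instance
  · have h1 : ((∑ x, ‖ψ x‖ ^ 2 : ℝ) : ℂ) = 1 := by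
      push_cast
      have h2 : ∀ x, ((‖ψ x‖ : ℝ) : ℂ) ^ 2 = 1 / 4 * ∑ t, piTensor (D t) x x := fun x => by
        rw [← hψ, ← Complex.mul_conj']; rfl
      simp only [h2, ← Finset.mul_sum]
      rw [Finset.sum_comm]
      have h3 : ∀ t, ∑ x, piTensor (D t) x x = if t = 0 then 4 else 0 := fun t => by
        change (piTensor (D t)).trace = _
        rw [trace_piTensor]
        simp only [D, weylPow, trace_piTensor]
        rw [hprod fun _ _ => (weyl t).trace, trace_weyl]
        split_ifs <;> norm_num
      simp [h3]
    exact_mod_cast h1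
  · rintro ⟨φ, hφ⟩
    let X : Fin 2 → Fin 2 → ∀ T : {T // T ∈ π.parts},
        {l : {l // l ∈ T.1} // l.1 = i ∨ l.1 = j} → Fin 2 :=
      fun u v T l => if l.1.1 = i then u else v
    have hX : ∀ u v, ψ (X u v) = bell 0 0 ![u, v] := fun u v => by
      simp [ψ, X, li, lj, hij.symm]
    -- A product vector has vanishing minors: the factor of `A` sees only the bit at `i`, every
    -- other factor only the bit at `j`. For `Φ₀₀` the left side is nonzero and the right side is
    -- zero.
    have h1 : ψ (X 0 0) * ψ (X 1 1) = ψ (X 0 1) * ψ (X 1 0) := by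
      simp only [hφ, ← Finset.prod_mul_distrib]
      refine Finset.prod_congr rfl fun T _ => ?_
      rcases eq_or_ne T A with rfl | hTA
      · have h2 : ∀ u v v', X u v A = X u v' A := fun u v v' => funext fun l => by
          simp [X, Finset.mem_singleton.1 l.1.2]
        rw [h2 0 0 1, h2 1 1 0]
      · have h2 : ∀ u u' v, X u v T = X u' v T := fun u u' v => funext fun l => by
          have h3 : l.1.1 ≠ i := fun h4 => hTA (Subtype.ext (π.eq_of_mem_parts T.2 h.1 l.1.2
            (Finset.mem_singleton.2 h4)))
          simp [X, h3]
        rw [h2 0 1 0, h2 1 0 1, mul_comm]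
    rw [hX, hX, hX, hX] at h1
    simp [bell] at h1
  · intro ε hε
    choose K hK1 hK2 using h.exists_measurement
    -- The correction acts on the qubit `i` alone, so the sign `sympSign r t` appears exactly once.
    let U : Fin 2 × Fin 2 → ∀ T : {T // T ∈ π.parts},
        Matrix ({l : {l // l ∈ T.1} // l.1 = i ∨ l.1 = j} → Fin 2)
          ({l : {l // l ∈ T.1} // l.1 = i ∨ l.1 = j} → Fin 2) ℂ :=
      fun r T => piTensor fun l => if l.1.1 = i then weyl r else 1
    have hU1 : ∀ r T, (U r T)ᴴ * U r T = 1 := fun r T => by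
      have h1 : ∀ l : {l : {l // l ∈ T.1} // l.1 = i ∨ l.1 = j},
          (if l.1.1 = i then weyl r else 1)ᴴ * (if l.1.1 = i then weyl r else 1) = 1 := fun l => by
        split_ifs
        · exact conjTranspose_mul_weyl r
        · simp
      simp only [U, piTensor_conjTranspose, piTensor_mul, h1]
      exact piTensor_one
    have hU2 : ∀ r t, (piTensor fun T => U r T * D t T * (U r T)ᴴ) =
        sympSign r t • piTensor (D t) := fun r t => by
      have h1 : ∀ (T : {T // T ∈ π.parts}) (l : {l : {l // l ∈ T.1} // l.1 = i ∨ l.1 = j}),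
          (if l.1.1 = i then weyl r else 1) * weyl t * (if l.1.1 = i then weyl r else 1)ᴴ =
            (if l.1.1 = i then sympSign r t else 1) • weyl t := fun T l => by
        split_ifs
        · exact weyl_conj r t
        · simp
      simp only [U, D, weylPow, piTensor_conj, h1, piTensor_smul]
      rw [hprod fun T l => if l.1.1 = i then sympSign r t else 1]
      simp [li, lj, hij.symm]
    obtain ⟨Λ, hΛ, hΛ2⟩ := exists_isLOCC_measure_correct K hK1
      (fun a => U (s + ∑ T, a T)) fun a => hU1 _
    refine ⟨1, Λ, hΛ, fun x y => ?_⟩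
    have h1 : groupState π ((1 / 2 ^ m : ℂ) • stabOp (Fin m) s) =
        (1 / 2 ^ m : ℂ) • groupState π (stabOp (Fin m) s) := rfl
    have h2 : Λ (copies 1 (groupState π ((1 / 2 ^ m : ℂ) • stabOp (Fin m) s))) =
        (1 / 4 : ℂ) • ∑ t, piTensor (D t) := by
      rw [hΛ2, h1, groupState_stabOp]
      simp only [Matrix.mul_smul, Matrix.smul_mul, ← Finset.smul_sum]
      rw [sum_measure_correct K _ D _ hK2 s U hU2, smul_smul]
      congr 1
      have h3 : ∀ T : {T // T ∈ π.parts}, (4 : ℂ) * (1 / 4 * ∏ l : {l // l ∈ T.1},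
          if l.1 = i ∨ l.1 = j then 1 else 2) =
            ∏ l : {l // l ∈ T.1}, if l.1 = i ∨ l.1 = j then 1 else 2 := fun T => by ring
      simp only [h3]
      rw [← prod_blocks π fun l => if l = i ∨ l = j then (1 : ℂ) else 2, ← prod_ite_one_two hij]
      have h4 : (∏ l : Fin m, if l = i ∨ l = j then (1 : ℂ) else 2) ≠ 0 :=
        Finset.prod_ne_zero_iff.2 fun l _ => by split_ifs <;> norm_num
      field_simp
    rw [h2, hψ, Matrix.smul_apply, Matrix.sum_apply, smul_eq_mul, sub_self, norm_zero]
    exact hε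

end Unlock

/-! ### Existence of pairings, and unlockability of the four sectors -/

/-- A set of even cardinality can be divided into pairs. -/
theorem exists_finpartition_pairs {α : Type*} [DecidableEq α] (k : ℕ) :
    ∀ s : Finset α, s.card = 2 * k → ∃ π : Finpartition s, ∀ T ∈ π.parts, T.card = 2 := by
  induction k with
  | zero =>
    intro s hs
    obtain rfl := Finset.card_eq_zero.1 hs
    exact ⟨Finpartition.empty _, fun T hT => absurd hT (Finset.notMem_empty T)⟩
  | succ k ih =>
    intro s hs
    obtain ⟨t, hts, ht⟩ := Finset.exists_subset_card_eq (show 2 ≤ s.card by omega)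
    obtain ⟨π, hπ⟩ := ih (s \ t) (by rw [Finset.card_sdiff_of_subset hts]; omega)
    refine ⟨π.extend (b := t) ?_ Finset.sdiff_disjoint (Finset.sdiff_union_of_subset hts), ?_⟩
    · rintro rfl
      simp at ht
    · intro T hT
      rcases Finset.mem_insert.1 hT with rfl | hT
      · exact ht
      · exact hπ T hT

theorem exists_pairsAllBut {n : ℕ} {i j : Fin (2 * n)} (hij : i ≠ j) :
    ∃ π : Finpartition (Finset.univ : Finset (Fin (2 * n))), PairsAllBut π i j := by
  obtain ⟨π, hπ⟩ := exists_finpartition_pairs (n - 1) (Finset.univ \ {i, j} : Finset (Fin (2 * n)))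
    (by rw [Finset.card_sdiff_of_subset (Finset.subset_univ _), Finset.card_pair hij,
      Finset.card_univ, Fintype.card_fin]; omega)
  let π' := π.extend (b := {i}) (c := Finset.univ \ {j}) (Finset.singleton_ne_empty i)
    (by simp) (by
      ext l
      by_cases h : l = i
      · simp [h, hij]
      · simp [h])
  let π'' := π'.extend (b := {j}) (c := Finset.univ) (Finset.singleton_ne_empty j)
    Finset.sdiff_disjoint (Finset.sdiff_union_of_subset (Finset.subset_univ _))
  refine ⟨π'', Finset.mem_insert_of_mem (Finset.mem_insert_self _ _),
    Finset.mem_insert_self _ _, fun T hT hi hj => ?_⟩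
  rcases Finset.mem_insert.1 hT with h | h
  · exact absurd h hj
  · rcases Finset.mem_insert.1 h with h | h
    · exact absurd h hi
    · exact hπ T h

theorem isUnlockableBoundEntangled_stabOp {n : ℕ} (hn : 2 ≤ n) (r : Fin 2 × Fin 2) :
    IsUnlockableBoundEntangled ((1 / 4 ^ n : ℂ) • stabOp (Fin (2 * n)) r) := by
  have hij : (⟨0, by omega⟩ : Fin (2 * n)) ≠ ⟨1, by omega⟩ := by simp
  obtain ⟨π, h⟩ := exists_pairsAllBut hij
  refine ⟨isBoundEntangled_stabOp hn r, π, ⟨_, h.1⟩, ⟨_, h.2.1⟩, ?_, ?_⟩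
  · simp [Subtype.ext_iff]
  · have := h.distillableBetween hij r
    rw [pow_mul] at this
    norm_num at this ⊢
    exact this

end

theorem mainTheorem4 :
    (∀ n : ℕ, 2 ≤ n →
      -- the state, and its closed form
      xzState n = (1 / 4 ^ n : ℂ) •
        ((1 + allQubits (2 * n) (pauli 1 0)) * (1 + allQubits (2 * n) (pauli 0 1))) ∧
      -- separability with respect to each partition into pairs
      (∀ π : Finpartition (Finset.univ : Finset (Fin (2 * n))),
        (∀ T ∈ π.parts, T.card = 2) → SeparableWrt π (xzState n)) ∧
      -- unlockable bound entanglement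
      IsUnlockableBoundEntangled (xzState n) ∧
      -- pure entanglement between any two parties, when the others are grouped into pairs
      (∀ i j : Fin (2 * n), i ≠ j →
        (∃ π : Finpartition (Finset.univ : Finset (Fin (2 * n))), PairsAllBut π i j) ∧
        ∀ (π : Finpartition (Finset.univ : Finset (Fin (2 * n)))) (h : PairsAllBut π i j),
          DistillableBetween (groupState π (xzState n)) ⟨{i}, h.1⟩ ⟨{j}, h.2.1⟩) ∧
      -- the generalized Smolin state, up to a local Pauli operation
      (∃ a b : Fin (2 * n) → Fin 2,
        xzState n = (piTensor fun i => pauli (a i) (b i)) * genSmolin n *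
          (piTensor fun i => pauli (a i) (b i))ᴴ) ∧
      -- the Bell state decomposition for an arbitrary division into pairs
      (∀ e : Fin n × Fin 2 ≃ Fin (2 * n),
        xzState n = (1 / 4 ^ (n - 1) : ℂ) •
          ∑ α : Fin n → Fin 2, ∑ β : Fin n → Fin 2,
            if ∑ i, α i = 0 ∧ ∑ i, β i = 0 then
              pairTensor e (fun i => bellProj (α i) (β i))
            else 0) ∧
      -- invariance under permutations of the parties
      (∀ τ : Equiv.Perm (Fin (2 * n)),
        (xzState n).submatrix (fun x => x ∘ τ) (fun x => x ∘ τ) = xzState n) ∧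
      -- the pair that is left over after Bell measurements on all the other pairs
      (∀ (e : Fin n × Fin 2 ≃ Fin (2 * n)) (k : Fin n) (α β : Fin n → Fin 2),
        bellMeasurement e k α β * xzState n * (bellMeasurement e k α β)ᴴ =
          (1 / 4 ^ (n - 1) : ℂ) •
            bellProj (∑ i ∈ Finset.univ.erase k, α i) (∑ i ∈ Finset.univ.erase k, β i)) ∧
      -- the decomposition of the space into four orthogonal subspaces
      (OrthogonalFamily ℂ (fun s => xzSector n s) (fun s => (xzSector n s).subtypeₗᵢ) ∧
        (⨆ s, xzSector n s) = ⊤ ∧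
        ∀ s, Module.finrank ℂ (xzSector n s) = 4 ^ (n - 1) ∧
          IsUnlockableBoundEntangled (maxMixed (xzSector n s)))) ∧
    -- the recursion, from `2 m` to `2 m + 2` qubits
    (∀ m : ℕ, 1 ≤ m →
      xzState (m + 1) = (1 / 4 : ℂ) • ∑ α : Fin 2, ∑ β : Fin 2,
        tensorPair
          (onFirst (2 * m) (pauli α β) * xzState m * (onFirst (2 * m) (pauli α β))ᴴ)
          (bellProj α β)) := by
  refine ⟨fun n hn => ?_, fun m hm => xzState_succ hm⟩
  have hn1 : 1 ≤ n := by omega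
  refine ⟨?_, separableWrt_xzState hn1, ?_, fun i j hij => ⟨exists_pairsAllBut hij, ?_⟩,
    exists_xzState_eq_pauli_conj_genSmolin hn1, xzState_eq_sum_pairTensor hn1,
    xzState_submatrix_perm hn1, bellMeasurement_xzState hn1, orthogonalFamily_xzSector n,
    iSup_xzSector n, fun s => ⟨finrank_xzSector hn1 s, ?_⟩⟩
  · rw [xzState_eq hn1, stabOp_eq_mul (even_card_fin_two_mul n), sympSign_zero, sympSign_zero,
      one_smul, one_smul, allQubits, allQubits, pauli_X, pauli_Z]
    rfl
  · rw [xzState_eq hn1]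
    exact isUnlockableBoundEntangled_stabOp hn 0
  · intro π h
    have h1 := h.distillableBetween hij 0
    rw [pow_mul, show (2 : ℂ) ^ 2 = 4 by norm_num, ← xzState_eq hn1] at h1
    exact h1
  · rw [maxMixed_xzSector hn1]
    exact isUnlockableBoundEntangled_stabOp hn _
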